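/- **Setting.** Let $(H,\|\cdot\|_H,\langle\cdot,\cdot\rangle_H)$ be a separable real Hilbert space, let $T\in(0,\infty)$, $\eta,\delta\in\mathbb R$, and let $(\Omega,\mathcal F,\mathbb P,(\mathcal F_t)_{t\in[0,T]})$ be a probability space with a normal filtration (right-continuous, and $\mathcal F_0$ contains all $\mathbb P$-null sets of $\mathcal F$). Let $A\colon D(A)\subseteq H\to H$ be a diagonal linear operator, that is, there are an orthonormal basis $(b_i)_{i\in I}$ of $H$ and real numbers $(\lambda_i)_{i\in I}$ such that $D(A)=\{v\in H\colon\sum_{i}|\lambda_i\langle b_i,v\rangle_H|^2<\infty\}$ and $Av=-\sum_i\lambda_i\langle b_i,v\rangle_H b_i$ for all $v\in D(A)$. Assume that $\operatorname{spectrum}(A)\subseteq(-\infty,\eta)$, and let $\sigma_p(A)$ be the point spectrum of $A$. Let $(H_q,\|\cdot\|_{H_q},\langle\cdot,\cdot\rangle_{H_q})$, $q\in\mathbb R$, be the family of interpolation spaces associated to $\eta-A$: for $q\ge 0$, $H_q=D((\eta-A)^q)$ with $\|v\|_{H_q}=\|(\eta-A)^qv\|_H$, and for $q<0$, $H_q$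 is the completion of $H$ with respect to $\|v\|_{H_q}=\|(\eta-A)^{q}v\|_H$. In terms of the coefficients $x_i=\langle b_i,x\rangle$, $H_q$ consists of all families $(x_i)_{i\in I}$ of real numbers with $\|x\|_{H_q}^2=\sum_i|(\eta+\lambda_i)^qx_i|^2<\infty$. For $t>0$ the operator $e^{tA}$, which multiplies the $i$-th coefficient by $e^{-\lambda_it}$, maps every $H_p$ boundedly into every $H_q$. For a Hilbert space $K$, $HS(\mathbb R,K)$ is the space of Hilbert–Schmidt operators from $\mathbb R$ to $K$, and for an $H_q$-valued random variable $Y$ we write $\|Y\|_{L^2(\mathbb P;H_q)}=(\mathbb E[\|Y\|_{H_q}^2])^{1/2}$. **Proposition.** Let $r,\beta\in[0,\infty)$, let $w\in H_{-\beta}\setminus\{0\}$, let $\xi\colon\Omega\to H_\delta$ be $\mathcal F_0/\mathcal B(H_\delta)$-measurable, let $B\colon H\to HS(\mathbb R,H_{-\beta})$ be the continuous map with $B(v)u=u\,\|v\|_H\,w$ for all $v\in H$, $u\in\mathbb R$, let $W\colon[0,T]\times\Omega\to\mathbb R$ be a standard $(\mathcal F_t)_{t\in[0,T]}$-Brownian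 motion, and let $X\colon[0,T]\times\Omega\to H_\delta$ be an $(\mathcal F_t)_{t\in[0,T]}$-predictable stochastic process with $X((0,T]\times\Omega)\subseteq H$ such that for all $t\in(0,T]$ $$\mathbb E\big[\|e^{tA}\xi\|_{H_{-r}}^2\big]+\int_0^t\mathbb E\big[\|e^{(t-s)A}B(X_s)\|_{HS(\mathbb R,H_{-r})}^2\big]\,ds<\infty$$ and, $\mathbb P$-almost surely, $$X_t=e^{tA}\xi+\int_0^te^{(t-s)A}B(X_s)\,dW_s ,$$ where the integral is the $H_{-r}$-valued Itô integral. Then $\mathbb P(\xi\in H_{-1/2})=1$, and for all $t\in(0,T]$ $$2^{-1/2}\,e^{-|\eta|t}\,\big(1-e^{-2[\eta-\sup(\sigma_p(A))]t}\big)^{1/2}\,\|e^{tA}w\|_{H_{-r}}\,\|\xi\|_{L^2(\mathbb P;H_{-1/2})}\;\le\;\|X_t\|_{L^2(\mathbb P;H_{-r})}\;<\;\infty .$$ -/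

import Mathlib

open MeasureTheory ProbabilityTheory Set Filter Topology
open scoped NNReal ENNReal

noncomputable section

namespace DiagonalSEE

/-! ### Unbounded operators: resolvent set, spectrum, point spectrum, diagonal operators -/

section Operators

variable {H : Type*} [NormedAddCommGroup H] [InnerProductSpace ℝ H]

/-- Resolvent set of an unbounded operator `A : D(A) ⊆ H → H`: those `z` for which
`z - A : D(A) → H` is bijective with a bounded inverse `R`. -/
def opResolventSet (A : H →ₗ.[ℝ] H) : Set ℝ :=
  {z | ∃ R : H →L[ℝ] H,
    (∀ v : H, ∃ h : R v ∈ A.domain, z • R v - A ⟨R v, h⟩ = v) ∧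
    ∀ v : A.domain, R (z • (v : H) - A v) = v}

/-- Spectrum of an unbounded operator. -/
def opSpectrum (A : H →ₗ.[ℝ] H) : Set ℝ := (opResolventSet A)ᶜ

/-- Point spectrum (set of eigenvalues) of an unbounded operator. -/
def pointSpectrum (A : H →ₗ.[ℝ] H) : Set ℝ :=
  {z | ∃ v : A.domain, (v : H) ≠ 0 ∧ A v = z • (v : H)}

/-- Fourier coefficients `(⟨b i, v⟩)_i` of `v ∈ H`. -/
def coeff {ι : Type*} (b : HilbertBasis ι ℝ H) (v : H) : ι → ℝ := fun i => inner ℝ (b i) v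

/-- `A` is the diagonal operator with orthonormal basis `b` and eigenvalues `-lam i`:
`D(A) = {v : ∑ |lam i ⟨b i, v⟩|² < ∞}` and `A v = - ∑ lam i ⟨b i, v⟩ b i` on `D(A)`. -/
structure IsDiagonal {ι : Type*} (A : H →ₗ.[ℝ] H) (b : HilbertBasis ι ℝ H) (lam : ι → ℝ) :
    Prop where
  mem_domain : ∀ v : H, v ∈ A.domain ↔ Summable fun i => (lam i * coeff b v i) ^ 2
  hasSum : ∀ v : A.domain, HasSum (fun i => -((lam i * coeff b v i) • b i)) (A v)

lemma coeff_injective {ι : Type*} (b : HilbertBasis ι ℝ H) : Function.Injective (coeff b) := by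
  intro v w h
  apply b.repr.injective
  ext i
  simpa [coeff, b.repr_apply_apply] using congrFun h i

open Classical in
/-- The element of `H` with a given family of Fourier coefficients
(with value `0` if there is no such element). -/
def toH {ι : Type*} (b : HilbertBasis ι ℝ H) (x : ι → ℝ) : H :=
  if h : ∃ v, coeff b v = x then h.choose else 0

lemma toH_coeff {ι : Type*} (b : HilbertBasis ι ℝ H) (v : H) : toH b (coeff b v) = v := by
  have h : ∃ u, coeff b u = coeff b v := ⟨v, rfl⟩
  rw [toH, dif_pos h]
  exact coeff_injective b h.choose_spec

end Operators

/-! ### The scale of Hilbert spaces attached to a strictly positive diagonal operator -/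

/-- Eigenvalue families that are bounded away from zero from below. -/
abbrev Weight (ι : Type*) := {μ : ι → ℝ // ∃ c > 0, ∀ i, c ≤ μ i}

section Interp

variable {ι : Type*}

lemma Weight.pos (μ : Weight ι) (i : ι) : 0 < μ.1 i := by
  obtain ⟨c, hc, h⟩ := μ.2
  exact hc.trans_le (h i)

/-- The coefficient families `x` with `∑ |(μ i)^r x i|² < ∞`. -/
def interpSubmodule (μ : Weight ι) (r : ℝ) : Submodule ℝ (ι → ℝ) where
  carrier := {x | Memℓp (fun i => μ.1 i ^ r * x i) 2}
  zero_mem' := by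
    have : (fun i => μ.1 i ^ r * (0 : ι → ℝ) i) = 0 := by ext; simp
    change Memℓp (fun i => μ.1 i ^ r * (0 : ι → ℝ) i) 2
    rw [this]; exact zero_memℓp
  add_mem' := by
    intro x y hx hy
    have : (fun i => μ.1 i ^ r * (x + y) i)
        = (fun i => μ.1 i ^ r * x i) + fun i => μ.1 i ^ r * y i := by
      ext i; simp [mul_add]
    change Memℓp (fun i => μ.1 i ^ r * (x + y) i) 2
    rw [this]; exact Memℓp.add hx hy
  smul_mem' := by
    intro c x hx
    have : (fun i => μ.1 i ^ r * (c • x) i) = c • fun i => μ.1 i ^ r * x i := by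
      ext i; simp [mul_left_comm]
    change Memℓp (fun i => μ.1 i ^ r * (c • x) i) 2
    rw [this]; exact Memℓp.const_smul hx c

/-- The interpolation space `H_r` associated to the diagonal operator with eigenvalues `μ i > 0`,
realised through Fourier coefficients with respect to the eigenbasis: the Hilbert space of all
`x : ι → ℝ` with `‖x‖_{H_r}² = ∑ |(μ i)^r x i|² < ∞`. For `r ≥ 0` this is the domain of the `r`-th
power of the operator with the norm of that power, for `r < 0` it is the completion of `H` with
respect to the norm of the `r`-th power. All these spaces lie in `ι → ℝ`, and `H` itself is
embedded into `ι → ℝ` by `coeff`. -/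
def InterpSpace (μ : Weight ι) (r : ℝ) : Type _ := ↥(interpSubmodule μ r)

instance (μ : Weight ι) (r : ℝ) : AddCommGroup (InterpSpace μ r) :=
  inferInstanceAs (AddCommGroup ↥(interpSubmodule μ r))

instance (μ : Weight ι) (r : ℝ) : Module ℝ (InterpSpace μ r) :=
  inferInstanceAs (Module ℝ ↥(interpSubmodule μ r))

namespace InterpSpace

variable {μ : Weight ι} {r : ℝ}

/-- A coefficient family in `H_r` as an element of `H_r`. -/
def mk (x : ι → ℝ) (h : x ∈ interpSubmodule μ r) : InterpSpace μ r := ⟨x, h⟩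

/-- The coefficient family of an element of `H_r`. -/
def coeffs (x : InterpSpace μ r) : ι → ℝ := x.1

/-- The isometry `x ↦ ((μ i)^r x i)_i` from `H_r` to `ℓ²` which defines the norm of `H_r`. -/
def toL2 (μ : Weight ι) (r : ℝ) : InterpSpace μ r →ₗ[ℝ] lp (fun _ : ι => ℝ) 2 where
  toFun x := ⟨fun i => μ.1 i ^ r * coeffs x i, x.2⟩
  map_add' x y := by
    ext i
    exact mul_add _ _ _
  map_smul' c x := by
    ext i
    exact mul_left_comm _ _ _

lemma toL2_injective (μ : Weight ι) (r : ℝ) : Function.Injective (toL2 μ r) := by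
  intro x y h
  apply Subtype.ext
  funext i
  have h' : μ.1 i ^ r * coeffs x i = μ.1 i ^ r * coeffs y i :=
    congrArg (fun z : lp (fun _ : ι => ℝ) 2 => z i) h
  exact mul_left_cancel₀ (Real.rpow_pos_of_pos (μ.pos i) r).ne' h'

instance : NormedAddCommGroup (InterpSpace μ r) :=
  NormedAddCommGroup.induced _ _ (toL2 μ r) (toL2_injective μ r)

instance : InnerProductSpace ℝ (InterpSpace μ r) where
  norm_smul_le c x := by
    change ‖toL2 μ r (c • x)‖ ≤ ‖c‖ * ‖toL2 μ r x‖
    rw [map_smul]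
    exact norm_smul_le _ _
  inner x y := inner ℝ (toL2 μ r x) (toL2 μ r y)
  norm_sq_eq_re_inner x := norm_sq_eq_re_inner (𝕜 := ℝ) (toL2 μ r x)
  conj_inner_symm x y := inner_conj_symm (𝕜 := ℝ) (toL2 μ r x) (toL2 μ r y)
  add_left x y z := by rw [map_add]; exact inner_add_left _ _ _
  smul_left x y c := by rw [map_smul]; exact inner_smul_left _ _ _

instance : MeasurableSpace (InterpSpace μ r) := borel _

instance : BorelSpace (InterpSpace μ r) := ⟨rfl⟩

lemma norm_def (x : InterpSpace μ r) : ‖x‖ = ‖toL2 μ r x‖ := rfl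

end InterpSpace

open Classical in
/-- The norm of `H_r` as a function on all coefficient families, with value `∞` outside `H_r`. -/
def interpENorm (μ : Weight ι) (r : ℝ) (x : ι → ℝ) : ℝ≥0∞ :=
  if h : x ∈ interpSubmodule μ r then ‖InterpSpace.mk x h‖ₑ else ⊤

lemma multiplier_memℓp {μ : Weight ι} {m : ι → ℝ} {p q C : ℝ}
    (h : ∀ i, |m i| * μ.1 i ^ q ≤ C * μ.1 i ^ p) (x : InterpSpace μ p) :
    (Memℓp (fun i => μ.1 i ^ q * (m i * x.coeffs i)) 2) ∧
      ∀ i, ‖μ.1 i ^ q * (m i * x.coeffs i)‖ ≤ ‖(C • InterpSpace.toL2 μ p x) i‖ := by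
  have key : ∀ i, ‖μ.1 i ^ q * (m i * x.coeffs i)‖ ≤ ‖(C • InterpSpace.toL2 μ p x) i‖ := by
    intro i
    have hq := Real.rpow_pos_of_pos (μ.pos i) q
    have hp := Real.rpow_pos_of_pos (μ.pos i) p
    have e : (C • InterpSpace.toL2 μ p x) i = C * (μ.1 i ^ p * x.coeffs i) := rfl
    rw [e, Real.norm_eq_abs, Real.norm_eq_abs, abs_mul, abs_mul, abs_mul, abs_mul,
      abs_of_pos hq, abs_of_pos hp]
    calc μ.1 i ^ q * (|m i| * |x.coeffs i|) = (|m i| * μ.1 i ^ q) * |x.coeffs i| := by ring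
      _ ≤ (C * μ.1 i ^ p) * |x.coeffs i| := mul_le_mul_of_nonneg_right (h i) (abs_nonneg _)
      _ ≤ (|C| * μ.1 i ^ p) * |x.coeffs i| := by gcongr; exact le_abs_self C
      _ = |C| * (μ.1 i ^ p * |x.coeffs i|) := by ring
  refine ⟨?_, key⟩
  have h2 : (0 : ℝ) < (2 : ℝ≥0∞).toReal := by norm_num
  have hs := (memℓp_gen_iff h2).1 (lp.memℓp (C • InterpSpace.toL2 μ p x))
  refine (memℓp_gen_iff h2).2 (hs.of_nonneg_of_le (fun i => by positivity) fun i => ?_)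
  exact Real.rpow_le_rpow (norm_nonneg _) (key i) h2.le

open Classical in
/-- The diagonal operator `x ↦ (m i * x i)_i` as a bounded operator from `H_p` to `H_q`
(with value `0` if it is not a bounded operator from `H_p` to `H_q`). -/
def multiplier (μ : Weight ι) (m : ι → ℝ) (p q : ℝ) : InterpSpace μ p →L[ℝ] InterpSpace μ q :=
  if h : ∃ C, ∀ i, |m i| * μ.1 i ^ q ≤ C * μ.1 i ^ p then
    LinearMap.mkContinuous
      { toFun := fun x => ⟨fun i => m i * x.coeffs i, (multiplier_memℓp h.choose_spec x).1⟩
        map_add' := fun x y => Subtype.ext (funext fun _ => mul_add _ _ _)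
        map_smul' := fun c x => Subtype.ext (funext fun _ => mul_left_comm _ _ _) }
      |h.choose| (fun x => by
        rw [InterpSpace.norm_def, InterpSpace.norm_def, ← Real.norm_eq_abs, ← norm_smul]
        exact lp.norm_mono (by norm_num) (multiplier_memℓp h.choose_spec x).2)
  else 0

lemma multiplier_coeffs (μ : Weight ι) (m : ι → ℝ) (p q : ℝ)
    (h : ∃ C, ∀ i, |m i| * μ.1 i ^ q ≤ C * μ.1 i ^ p) (x : InterpSpace μ p) (i : ι) :
    (multiplier μ m p q x).coeffs i = m i * x.coeffs i := by
  rw [multiplier, dif_pos h]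
  rfl

end Interp

/-! ### The semigroup generated by a diagonal operator -/

namespace IsDiagonal

variable {H : Type*} [NormedAddCommGroup H] [InnerProductSpace ℝ H] {ι : Type*}
  {A : H →ₗ.[ℝ] H} {b : HilbertBasis ι ℝ H} {lam : ι → ℝ} {η : ℝ}

lemma apply_basis (hA : IsDiagonal A b lam) (i : ι) :
    ∃ h : b i ∈ A.domain, A ⟨b i, h⟩ = -(lam i • b i) := by
  classical
  have hc : ∀ j, coeff b (b i) j = if j = i then 1 else 0 := fun j =>
    orthonormal_iff_ite.1 b.orthonormal j i
  have h : b i ∈ A.domain := by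
    rw [hA.mem_domain]
    refine summable_of_ne_finset_zero (s := {i}) fun j hj => ?_
    simp [hc, Finset.notMem_singleton.1 hj]
  refine ⟨h, (hA.hasSum ⟨b i, h⟩).unique ?_⟩
  have := hasSum_single (f := fun j => -((lam j * coeff b (b i) j) • b j)) i
    (fun j hj => by simp [hc, hj])
  simpa [hc] using this

lemma weight_bound (hA : IsDiagonal A b lam) (hη : opSpectrum A ⊆ Iio η) :
    ∃ c > 0, ∀ i, c ≤ η + lam i := by
  have hmem : η ∈ opResolventSet A := by
    by_contra h
    exact lt_irrefl η (hη h)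
  obtain ⟨R, -, hR⟩ := hmem
  have hne : ∀ i, b i ≠ 0 := fun i h0 => by
    have := b.orthonormal.1 i
    rw [h0, norm_zero] at this
    exact zero_ne_one this
  have hpos : ∀ i, 0 < η + lam i := by
    intro i
    obtain ⟨h, hi⟩ := hA.apply_basis i
    have : -lam i ∈ opSpectrum A := by
      rintro ⟨S, -, hS⟩
      have := hS ⟨b i, h⟩
      rw [hi, neg_smul, sub_self, map_zero] at this
      exact hne i this.symm
    have := hη this
    simp only [mem_Iio] at this
    linarith
  refine ⟨(‖R‖ + 1)⁻¹, by positivity, fun i => ?_⟩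
  obtain ⟨h, hi⟩ := hA.apply_basis i
  have h1 := hR ⟨b i, h⟩
  rw [hi, sub_neg_eq_add, ← add_smul, map_smul] at h1
  have h2 : ‖b i‖ = 1 := b.orthonormal.1 i
  have h3 : 1 = (η + lam i) * ‖R (b i)‖ := by
    rw [← h2, ← abs_of_pos (hpos i), ← Real.norm_eq_abs, ← norm_smul, h1]
  have h4 : ‖R (b i)‖ ≤ ‖R‖ + 1 := by
    have := R.le_opNorm (b i)
    rw [h2] at this
    linarith
  rw [inv_le_iff_one_le_mul₀ (by positivity)]
  nlinarith [hpos i]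

/-- The eigenvalues `η + lam i` of `η - A`. -/
def weight (hA : IsDiagonal A b lam) (hη : opSpectrum A ⊆ Iio η) : Weight ι :=
  ⟨fun i => η + lam i, hA.weight_bound hη⟩

/-- The interpolation space `H_r` associated to `η - A`. -/
abbrev Interp (hA : IsDiagonal A b lam) (hη : opSpectrum A ⊆ Iio η) (r : ℝ) : Type _ :=
  InterpSpace (hA.weight hη) r

/-- The operator `e^{tA}` from `H_p` to `H_q`; it multiplies the `i`-th coefficient by
`exp (-lam i * t)` and is a bounded operator from `H_p` to `H_q` whenever `t > 0`. -/
def semigroup (hA : IsDiagonal A b lam) (hη : opSpectrum A ⊆ Iio η) (t p q : ℝ) :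
    hA.Interp hη p →L[ℝ] hA.Interp hη q :=
  multiplier (hA.weight hη) (fun i => Real.exp (-lam i * t)) p q

lemma semigroup_coeffs (hA : IsDiagonal A b lam) (hη : opSpectrum A ⊆ Iio η) {t : ℝ} (ht : 0 < t)
    (p q : ℝ) (x : hA.Interp hη p) (i : ι) :
    (hA.semigroup hη t p q x).coeffs i = Real.exp (-lam i * t) * x.coeffs i := by
  refine multiplier_coeffs _ _ _ _ ?_ x i
  obtain ⟨c, hc, hcμ⟩ := hA.weight_bound hη
  have hbdd : ∃ D, ∀ y : ℝ, c ≤ y → y ^ (q - p) * Real.exp (-t * y) ≤ D := by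
    have hlim := tendsto_rpow_mul_exp_neg_mul_atTop_nhds_zero (q - p) t ht
    obtain ⟨N, hN⟩ := eventually_atTop.1 (hlim.eventually_le_const zero_lt_one)
    have hcont : ContinuousOn (fun y : ℝ => y ^ (q - p) * Real.exp (-t * y)) (Icc c N) := by
      refine ContinuousOn.mul (fun y hy => ?_) (by fun_prop)
      exact (Real.continuousAt_rpow_const y (q - p)
        (Or.inl (hc.trans_le hy.1).ne')).continuousWithinAt
    obtain ⟨D, hD⟩ := isCompact_Icc.bddAbove_image hcont
    refine ⟨max D 1, fun y hy => ?_⟩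
    rcases le_total y N with h | h
    · exact (hD ⟨y, ⟨hy, h⟩, rfl⟩).trans (le_max_left _ _)
    · exact (hN y h).trans (le_max_right _ _)
  obtain ⟨D, hD⟩ := hbdd
  refine ⟨Real.exp (η * t) * D, fun j => ?_⟩
  have hμ : 0 < η + lam j := hc.trans_le (hcμ j)
  change |Real.exp (-lam j * t)| * (η + lam j) ^ q ≤ Real.exp (η * t) * D * (η + lam j) ^ p
  have e1 : Real.exp (-lam j * t) = Real.exp (η * t) * Real.exp (-t * (η + lam j)) := by
    rw [← Real.exp_add]; ring_nf
  have e2 : (η + lam j) ^ q = (η + lam j) ^ (q - p) * (η + lam j) ^ p := by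
    rw [← Real.rpow_add hμ]; ring_nf
  rw [abs_of_pos (Real.exp_pos _), e1, e2]
  have := hD _ (hcμ j)
  have hp := Real.rpow_pos_of_pos hμ p
  calc _ = Real.exp (η * t) * ((η + lam j) ^ (q - p) * Real.exp (-t * (η + lam j)))
        * (η + lam j) ^ p := by ring
    _ ≤ _ := by gcongr

end IsDiagonal

/-! ### Stochastic bases, Brownian motion, and the Itô integral -/

section Stochastic

variable {T : ℝ} {Ω : Type*} {mΩ : MeasurableSpace Ω}

/-- Lebesgue measure on `[0,T]`. -/
def timeMeasure (T : ℝ) : Measure (Icc (0 : ℝ) T) := Measure.comap Subtype.val volume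

/-- A filtration on `[0,T]` is normal if `ℱ 0` contains all events of probability zero and if it is
right-continuous. -/
structure IsNormalFiltration [Fact ((0 : ℝ) ≤ T)] (ℱ : Filtration (Icc (0 : ℝ) T) mΩ)
    (P : Measure Ω) : Prop where
  null_sets : ∀ N : Set Ω, MeasurableSet N → P N = 0 → MeasurableSet[ℱ ⊥] N
  right_continuous : ∀ t : Icc (0 : ℝ) T, (t : ℝ) < T → ⨅ s > t, ℱ s = ℱ t

/-- `W` is a standard real-valued Brownian motion on `[0,T]` with respect to the filtration `ℱ`. -/
structure IsStandardBrownianMotion [Fact ((0 : ℝ) ≤ T)] (ℱ : Filtration (Icc (0 : ℝ) T) mΩ)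
    (P : Measure Ω) (W : Icc (0 : ℝ) T → Ω → ℝ) : Prop where
  adapted : ∀ t, Measurable[ℱ t] (W t)
  zero : ∀ᵐ ω ∂P, W ⊥ ω = 0
  continuous : ∀ᵐ ω ∂P, Continuous fun t => W t ω
  law : ∀ s t : Icc (0 : ℝ) T, s ≤ t →
    P.map (fun ω => W t ω - W s ω) = gaussianReal 0 (Real.toNNReal ((t : ℝ) - s))
  indep : ∀ s t : Icc (0 : ℝ) T, s ≤ t →
    Indep (MeasurableSpace.comap (fun ω => W t ω - W s ω) inferInstance) (ℱ s) P

/-- Elementary predictable processes `∑_{k < n} 1_{(t_k, t_{k+1}]} φ_k` with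
`t_0 ≤ t_1 ≤ … ≤ t_n` in `[0,T]` and `φ_k` an `ℱ (t_k)`-measurable random variable that takes
finitely many values in `K`. -/
structure ElementaryProcess (ℱ : Filtration (Icc (0 : ℝ) T) mΩ) (K : Type*)
    [TopologicalSpace K] where
  n : ℕ
  time : Fin (n + 1) → Icc (0 : ℝ) T
  mono : Monotone time
  value : Fin n → Ω → K
  measurable : ∀ k, StronglyMeasurable[ℱ (time k.castSucc)] (value k)
  finite_range : ∀ k, (range (value k)).Finite

variable {ℱ : Filtration (Icc (0 : ℝ) T) mΩ} {K : Type*} [NormedAddCommGroup K] [NormedSpace ℝ K]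

open Classical in
/-- The elementary process as a function of time and `ω`. -/
def ElementaryProcess.eval (E : ElementaryProcess ℱ K) (s : Icc (0 : ℝ) T) (ω : Ω) : K :=
  ∑ k : Fin E.n, if s ∈ Ioc (E.time k.castSucc) (E.time k.succ) then E.value k ω else 0

/-- The stochastic integral `∫_0^t E_s dW_s` of an elementary process. -/
def ElementaryProcess.integral (E : ElementaryProcess ℱ K) (W : Icc (0 : ℝ) T → Ω → ℝ)
    (t : Icc (0 : ℝ) T) (ω : Ω) : K :=
  ∑ k : Fin E.n,
    (W (min (E.time k.succ) t) ω - W (min (E.time k.castSucc) t) ω) • E.value k ω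

/-- `I` is (a version of) the Itô integral `∫_0^t Φ_s dW_s` of the predictable, square-integrable
`K`-valued process `Φ`: the `L²(P; K)`-limit of the integrals of elementary processes which converge
to `Φ` in `L²([0,t] × Ω; K)`. Here `K` is identified with `HS(ℝ, K)` via `x ↦ (u ↦ u x)`. -/
structure IsItoIntegral [Fact ((0 : ℝ) ≤ T)] (ℱ : Filtration (Icc (0 : ℝ) T) mΩ) (P : Measure Ω)
    (W : Icc (0 : ℝ) T → Ω → ℝ) (Φ : Icc (0 : ℝ) T → Ω → K) (t : Icc (0 : ℝ) T) (I : Ω → K) :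
    Prop where
  predictable : AEStronglyMeasurable[ℱ.predictable] (Function.uncurry Φ)
    (((timeMeasure T).restrict (Iic t)).prod P)
  sq_integrable : ∫⁻ s in Iic t, ∫⁻ ω, ‖Φ s ω‖ₑ ^ 2 ∂P ∂(timeMeasure T) < ∞
  memLp : MemLp I 2 P
  approx : ∃ E : ℕ → ElementaryProcess ℱ K,
    Tendsto (fun n => ∫⁻ s in Iic t, ∫⁻ ω, ‖(E n).eval s ω - Φ s ω‖ₑ ^ 2 ∂P ∂(timeMeasure T)) atTop (𝓝 0) ∧
    Tendsto (fun n => eLpNorm (fun ω => (E n).integral W t ω - I ω) 2 P) atTop (𝓝 0)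

/-- The Hilbert–Schmidt norm of an operator `ℝ → K`, that is, the sum over the orthonormal basis
`{1}` of `ℝ`; it coincides with the operator norm. -/
def hsENorm (L : ℝ →L[ℝ] K) : ℝ≥0∞ := ‖L 1‖ₑ

end Stochastic

end DiagonalSEE

end

noncomputable section

namespace DiagonalSEE

/-! ### Increments of Brownian motion -/

section BrownianIncrements

variable {T : ℝ} [Fact ((0 : ℝ) ≤ T)] {Ω : Type*} {mΩ : MeasurableSpace Ω} {P : Measure Ω}
  {ℱ : Filtration (Icc (0 : ℝ) T) mΩ} {W : Icc (0 : ℝ) T → Ω → ℝ}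

namespace IsStandardBrownianMotion

/-! Write `a i` for the second moment of the `i`-th coefficient of `ξ`. The Itô integral in the mild
formula is orthogonal in L² to everything known at time zero, in particular to the coefficients of
`ξ`. Hence the second moments of the coefficients of `X s` dominate both those of `e^{sA}ξ` and
those of the integral (`IsItoIntegral.lintegral_tsum_le`). The first domination, summed in `H`,
gives `E‖X s‖² ≥ ∑ exp (-2 lam i s) a i`. The second, combined with the Itô isometry at time `t`,
gives `E‖X t‖²_{-r} ≥ ∫₀ᵗ ‖e^{(t-s)A}w‖²_{-r} E‖X s‖² ds`.

Since `η + lam i > 0`, one has `‖e^{(t-s)A}w‖² ≥ exp (-2ηs) ‖e^{tA}w‖²`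
(`IsDiagonal.enorm_semigroup_mul_le`). The integrand is thus at least `‖e^{tA}w‖² ∑ a i exp (-2(η +
lam i)s)`. Integrating in time produces the factor `(1 - exp (-2(η + lam i)t)) / (2(η + lam i))`.
Here `1 / (η + lam i)` is exactly the weight of the squared norm of `H_{-1/2}`, and the numerator is
bounded below through any `γ ≤ η + lam i`; this is `lintegral_interpENorm_sq_lower_bound`.

A strictly positive `γ` forces `ξ ∈ H_{-1/2}` almost surely, because the second moment of `X t` in
`H_{-r}` is finite. The choice `γ = η - sup σ_p(A)` gives the stated estimate, even without the
factor `exp (-|η|t) ≤ 1`. -/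

lemma measurable_increment (hW : IsStandardBrownianMotion ℱ P W) (s u : Icc (0 : ℝ) T) :
    Measurable fun ω => W u ω - W s ω :=
  ((hW.adapted u).mono (ℱ.le u) le_rfl).sub ((hW.adapted s).mono (ℱ.le s) le_rfl)

lemma memLp_increment (hW : IsStandardBrownianMotion ℱ P W) {s u : Icc (0 : ℝ) T} (h : s ≤ u) :
    MemLp (fun ω => W u ω - W s ω) 2 P := by
  have hm := (hW.measurable_increment s u).aemeasurable (μ := P)
  have := memLp_id_gaussianReal' (μ := 0) (v := Real.toNNReal ((u : ℝ) - s)) 2 (by simp)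
  rw [← hW.law s u h, memLp_map_measure_iff aestronglyMeasurable_id hm] at this
  exact this

lemma integral_increment (hW : IsStandardBrownianMotion ℱ P W) {s u : Icc (0 : ℝ) T}
    (h : s ≤ u) : ∫ ω, (W u ω - W s ω) ∂P = 0 := by
  have hm := (hW.measurable_increment s u).aemeasurable (μ := P)
  rw [← integral_map (f := fun x : ℝ => x) hm aestronglyMeasurable_id, hW.law s u h,
    integral_id_gaussianReal]

lemma integral_increment_sq (hW : IsStandardBrownianMotion ℱ P W) {s u : Icc (0 : ℝ) T}
    (h : s ≤ u) : ∫ ω, (W u ω - W s ω) ^ 2 ∂P = (u : ℝ) - s := by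
  have hm := (hW.measurable_increment s u).aemeasurable (μ := P)
  have hv := variance_id_gaussianReal (μ := 0) (v := Real.toNNReal ((u : ℝ) - s))
  rw [variance_of_integral_eq_zero aemeasurable_id (by simp), ← hW.law s u h,
    integral_map hm (by fun_prop)] at hv
  simpa [Real.coe_toNNReal _ (sub_nonneg.2 (show (s : ℝ) ≤ u from h))] using hv

lemma indepFun_increment (hW : IsStandardBrownianMotion ℱ P W) {s u : Icc (0 : ℝ) T}
    (h : s ≤ u) {g : Ω → ℝ} (hg : Measurable[ℱ s] g) :
    IndepFun (fun ω => W u ω - W s ω) g P := by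
  rw [IndepFun_iff_Indep]
  exact indep_of_indep_of_le_right (hW.indep s u h) hg.comap_le

/-- If `s ≤ t`, the stopped increment starts at `s`, so it is centred and independent of `g`. If `t
≤ s`, both stopped times equal `t` and the increment vanishes. No integrability of `g` is needed,
since the product rule for independent variables holds for Bochner integrals with their default
value zero. -/
lemma integral_stopped_increment_mul (hW : IsStandardBrownianMotion ℱ P W)
    {s u : Icc (0 : ℝ) T} (h : s ≤ u) (t : Icc (0 : ℝ) T) {g : Ω → ℝ} (hg : Measurable[ℱ s] g) :
    ∫ ω, (W (min u t) ω - W (min s t) ω) * g ω ∂P = 0 := by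
  rcases le_total s t with hst | hst
  · rw [min_eq_left hst, (hW.indepFun_increment (le_min h hst) hg).integral_fun_mul_eq_mul_integral
      (hW.measurable_increment _ _).aestronglyMeasurable
      (hg.mono (ℱ.le s) le_rfl).aestronglyMeasurable, hW.integral_increment (le_min h hst),
      zero_mul]
  · simp [min_eq_right hst, min_eq_right (hst.trans h)]

lemma integral_stopped_increment_sq_mul (hW : IsStandardBrownianMotion ℱ P W)
    {s u : Icc (0 : ℝ) T} (h : s ≤ u) (t : Icc (0 : ℝ) T) {g : Ω → ℝ} (hg : Measurable[ℱ s] g) :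
    ∫ ω, (W (min u t) ω - W (min s t) ω) ^ 2 * g ω ∂P
      = (((min u t : Icc (0 : ℝ) T) : ℝ) - (min s t : Icc (0 : ℝ) T)) * ∫ ω, g ω ∂P := by
  rcases le_total s t with hst | hst
  · have hind : IndepFun (fun ω => (W (min u t) ω - W s ω) ^ 2) g P :=
      (hW.indepFun_increment (le_min h hst) hg).comp (φ := fun x : ℝ => x ^ 2) (ψ := id)
        (by fun_prop) measurable_id
    rw [min_eq_left hst, hind.integral_fun_mul_eq_mul_integral
      ((hW.measurable_increment _ _).pow_const 2).aestronglyMeasurable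
      (hg.mono (ℱ.le s) le_rfl).aestronglyMeasurable, hW.integral_increment_sq (le_min h hst)]
  · simp [min_eq_right hst, min_eq_right (hst.trans h)]

end IsStandardBrownianMotion

end BrownianIncrements

/-! ### Elementary processes -/

section Elementary

variable {T : ℝ} {Ω : Type*} {mΩ : MeasurableSpace Ω} {ℱ : Filtration (Icc (0 : ℝ) T) mΩ}

lemma lintegral_enorm_sq_eq_ofReal_integral {α F : Type*} {mα : MeasurableSpace α}
    {m : Measure α} [NormedAddCommGroup F] {f : α → F} (hf : MemLp f 2 m) :
    ∫⁻ x, ‖f x‖ₑ ^ 2 ∂m = ENNReal.ofReal (∫ x, ‖f x‖ ^ 2 ∂m) := by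
  rw [ofReal_integral_eq_lintegral_ofReal hf.norm.integrable_sq (by filter_upwards; intros; positivity)]
  congr with x
  rw [← ofReal_norm, ENNReal.ofReal_pow (norm_nonneg _)]

lemma timeMeasure_Ioc_inter_Iic {a c : Icc (0 : ℝ) T} (t : Icc (0 : ℝ) T) :
    timeMeasure T (Ioc a c ∩ Iic t)
      = ENNReal.ofReal (((min c t : Icc (0 : ℝ) T) : ℝ) - (min a t : Icc (0 : ℝ) T)) := by
  have himg : Subtype.val '' (Ioc a c ∩ Iic t) = Ioc (a : ℝ) (min c t : Icc (0 : ℝ) T) := by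
    ext x
    constructor
    · rintro ⟨y, ⟨⟨h1, h2⟩, h3⟩, rfl⟩
      exact ⟨h1, show y ≤ min c t from le_min h2 h3⟩
    · rintro ⟨h1, h2⟩
      have hx : x ∈ Icc (0 : ℝ) T := ⟨a.2.1.trans h1.le, h2.trans (min c t).2.2⟩
      have h2' : (⟨x, hx⟩ : Icc (0 : ℝ) T) ≤ min c t := h2
      exact ⟨⟨x, hx⟩, ⟨⟨h1, h2'.trans (min_le_left _ _)⟩, h2'.trans (min_le_right _ _)⟩, rfl⟩
  rw [timeMeasure, (MeasurableEmbedding.subtype_coe measurableSet_Icc).comap_apply, himg,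
    Real.volume_Ioc]
  -- When `t ≤ a` the two differences need not agree, but both are nonpositive and `ENNReal.ofReal`
  -- truncates them to zero.
  rcases le_total a t with h | h
  · rw [min_eq_left h]
  · have h1 : ((min c t : Icc (0 : ℝ) T) : ℝ) ≤ t := (min_le_right c t : min c t ≤ t)
    have h2 : (t : ℝ) ≤ a := h
    rw [min_eq_right h, ENNReal.ofReal_of_nonpos (by linarith), ENNReal.ofReal_of_nonpos (by linarith)]

namespace ElementaryProcess

variable {K : Type*} [NormedAddCommGroup K]

lemma exists_norm_value_le (E : ElementaryProcess ℱ K) (k : Fin E.n) :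
    ∃ C, ∀ ω, ‖E.value k ω‖ ≤ C := by
  obtain ⟨C, hC⟩ := ((E.finite_range k).image norm).bddAbove
  exact ⟨C, fun ω => hC ⟨_, ⟨ω, rfl⟩, rfl⟩⟩

lemma time_le (E : ElementaryProcess ℱ K) (k : Fin E.n) :
    E.time k.castSucc ≤ E.time k.succ :=
  E.mono (Fin.castSucc_le_succ k)

lemma time_le_of_lt (E : ElementaryProcess ℱ K) {k l : Fin E.n} (h : k < l) :
    E.time k.succ ≤ E.time l.castSucc :=
  E.mono (by rw [Fin.le_def]; exact h)

lemma memLp_value (E : ElementaryProcess ℱ K) {P : Measure Ω} [IsFiniteMeasure P] (k : Fin E.n) :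
    MemLp (E.value k) 2 P := by
  obtain ⟨C, hC⟩ := E.exists_norm_value_le k
  exact MemLp.of_bound ((E.measurable k).mono (ℱ.le _)).aestronglyMeasurable C (ae_of_all _ hC)

/-- The intervals are pairwise disjoint by monotonicity of the times, so at most one summand is
nonzero and squaring creates no cross terms. -/
lemma enorm_eval_sq (E : ElementaryProcess ℱ K) (s : Icc (0 : ℝ) T) (ω : Ω) :
    ‖E.eval s ω‖ₑ ^ 2 = ∑ k, (Ioc (E.time k.castSucc) (E.time k.succ)).indicator
      (fun _ => ‖E.value k ω‖ₑ ^ 2) s := by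
  classical
  unfold eval
  by_cases h : ∃ k : Fin E.n, s ∈ Ioc (E.time k.castSucc) (E.time k.succ)
  · obtain ⟨k, hk⟩ := h
    have hne : ∀ l, l ≠ k → s ∉ Ioc (E.time l.castSucc) (E.time l.succ) := by
      intro l hl hs
      rcases lt_or_gt_of_ne hl with h | h
      · exact absurd (hs.2.trans (E.time_le_of_lt h)) (not_le.2 hk.1)
      · exact absurd (hk.2.trans (E.time_le_of_lt h)) (not_le.2 hs.1)
    rw [Finset.sum_eq_single k (fun l _ hl => if_neg (hne l hl)) (by simp), if_pos hk,
      Finset.sum_eq_single k (fun l _ hl => indicator_of_notMem (hne l hl) _) (by simp),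
      indicator_of_mem hk]
  · push Not at h
    rw [Finset.sum_eq_zero fun k _ => if_neg (h k),
      Finset.sum_eq_zero fun k _ => indicator_of_notMem (h k) _]
    simp

lemma stronglyMeasurable_eval (E : ElementaryProcess ℱ K) :
    StronglyMeasurable (Function.uncurry E.eval) := by
  classical
  have : Function.uncurry E.eval = fun p => ∑ k, (Prod.fst ⁻¹' Ioc (E.time k.castSucc)
      (E.time k.succ)).indicator (fun p : Icc (0 : ℝ) T × Ω => E.value k p.2) p := by
    ext p
    simp [Function.uncurry, eval, indicator_apply]
  rw [this]
  refine Finset.stronglyMeasurable_fun_sum _ fun k _ => StronglyMeasurable.indicator ?_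
    (measurable_fst measurableSet_Ioc)
  exact ((E.measurable k).mono (ℱ.le _)).comp_measurable measurable_snd

lemma lintegral_enorm_eval_sq (E : ElementaryProcess ℱ K) (P : Measure Ω)
    (t : Icc (0 : ℝ) T) :
    ∫⁻ s in Iic t, ∫⁻ ω, ‖E.eval s ω‖ₑ ^ 2 ∂P ∂(timeMeasure T)
      = ∑ k, ENNReal.ofReal (((min (E.time k.succ) t : Icc (0 : ℝ) T) : ℝ)
          - (min (E.time k.castSucc) t : Icc (0 : ℝ) T)) * ∫⁻ ω, ‖E.value k ω‖ₑ ^ 2 ∂P := by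
  have hm : ∀ k, Measurable fun ω => ‖E.value k ω‖ₑ ^ 2 := fun k =>
    ((E.measurable k).mono (ℱ.le _)).enorm.pow_const 2
  have inner : ∀ s, ∫⁻ ω, ‖E.eval s ω‖ₑ ^ 2 ∂P
      = ∑ k, (Ioc (E.time k.castSucc) (E.time k.succ)).indicator
        (fun _ => ∫⁻ ω, ‖E.value k ω‖ₑ ^ 2 ∂P) s := by
    intro s
    simp_rw [E.enorm_eval_sq s]
    rw [lintegral_finsetSum]
    · refine Finset.sum_congr rfl fun k _ => ?_
      by_cases h : s ∈ Ioc (E.time k.castSucc) (E.time k.succ)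
      · simp [indicator_of_mem h]
      · simp [indicator_of_notMem h]
    · intro k _
      by_cases h : s ∈ Ioc (E.time k.castSucc) (E.time k.succ)
      · simpa [indicator_of_mem h] using hm k
      · simp [indicator_of_notMem h]
  simp_rw [inner]
  rw [lintegral_finsetSum _ fun k _ => measurable_const.indicator measurableSet_Ioc]
  refine Finset.sum_congr rfl fun k _ => ?_
  rw [lintegral_indicator_const measurableSet_Ioc, Measure.restrict_apply measurableSet_Ioc,
    timeMeasure_Ioc_inter_Iic, mul_comm]

variable [InnerProductSpace ℝ K] [Fact ((0 : ℝ) ≤ T)] {P : Measure Ω}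
  {W : Icc (0 : ℝ) T → Ω → ℝ}

lemma memLp_summand (E : ElementaryProcess ℱ K) (hW : IsStandardBrownianMotion ℱ P W)
    (t : Icc (0 : ℝ) T) (k : Fin E.n) :
    MemLp (fun ω => (W (min (E.time k.succ) t) ω - W (min (E.time k.castSucc) t) ω)
      • E.value k ω) 2 P := by
  obtain ⟨C, hC⟩ := E.exists_norm_value_le k
  refine (hW.memLp_increment (min_le_min_right t (E.time_le k))).of_le_mul (c := C)
    ((hW.measurable_increment _ _).stronglyMeasurable.smul
      ((E.measurable k).mono (ℱ.le _))).aestronglyMeasurable (ae_of_all _ fun ω => ?_)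
  rw [norm_smul, mul_comm]
  exact mul_le_mul_of_nonneg_right (hC ω) (norm_nonneg _)

lemma memLp_integral (E : ElementaryProcess ℱ K) (hW : IsStandardBrownianMotion ℱ P W)
    (t : Icc (0 : ℝ) T) : MemLp (E.integral W t) 2 P :=
  memLp_finsetSum _ fun k _ => E.memLp_summand hW t k

/-- Each `ζ * L (E.value k)` is known at the left endpoint of its interval, so the Brownian
increment after it averages to zero. This is the source of the orthogonality between the initial
value and the noise. -/
lemma integral_mul_eq_zero (E : ElementaryProcess ℱ K) (hW : IsStandardBrownianMotion ℱ P W)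
    (t : Icc (0 : ℝ) T) (L : K →L[ℝ] ℝ) {ζ : Ω → ℝ} (hζ : Measurable[ℱ ⊥] ζ)
    (hζ2 : MemLp ζ 2 P) : ∫ ω, ζ ω * L (E.integral W t ω) ∂P = 0 := by
  have h : ∀ k : Fin E.n, Integrable (fun ω => ζ ω *
      L ((W (min (E.time k.succ) t) ω - W (min (E.time k.castSucc) t) ω) • E.value k ω)) P :=
    fun k => hζ2.integrable_mul (L.comp_memLp' (E.memLp_summand hW t k))
  simp_rw [integral, map_sum, Finset.mul_sum]
  rw [integral_finsetSum _ fun k _ => h k]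
  refine Finset.sum_eq_zero fun k _ => ?_
  refine Eq.trans ?_ (hW.integral_stopped_increment_mul (E.time_le k) t
    (g := fun ω => ζ ω * L (E.value k ω)) ?_)
  · refine integral_congr_ae (ae_of_all _ fun ω => ?_)
    simp only [map_smul, smul_eq_mul]
    ring
  · exact (hζ.mono (ℱ.mono bot_le) le_rfl).mul
      (L.continuous.comp_stronglyMeasurable (E.measurable k)).measurable

/-- The earlier increment and both values are known when the `l`-th interval starts; only the later,
centred increment is independent of that past. -/
lemma integral_inner_summand_of_lt (E : ElementaryProcess ℱ K)
    (hW : IsStandardBrownianMotion ℱ P W) (t : Icc (0 : ℝ) T) {k l : Fin E.n} (h : k < l) :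
    ∫ ω, inner ℝ ((W (min (E.time k.succ) t) ω - W (min (E.time k.castSucc) t) ω) • E.value k ω)
      ((W (min (E.time l.succ) t) ω - W (min (E.time l.castSucc) t) ω) • E.value l ω) ∂P = 0 := by
  have hkl := E.time_le_of_lt h
  refine Eq.trans ?_ (hW.integral_stopped_increment_mul (E.time_le l) t
    (g := fun ω => (W (min (E.time k.succ) t) ω - W (min (E.time k.castSucc) t) ω)
      * inner ℝ (E.value k ω) (E.value l ω)) ?_)
  · refine integral_congr_ae (ae_of_all _ fun ω => ?_)
    simp only [inner_smul_left, inner_smul_right, RCLike.conj_to_real]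
  · refine Measurable.mul (Measurable.sub ?_ ?_) (StronglyMeasurable.measurable ?_)
    · exact (hW.adapted _).mono (ℱ.mono ((min_le_left _ _).trans hkl)) le_rfl
    · exact (hW.adapted _).mono (ℱ.mono ((min_le_left _ _).trans ((E.time_le k).trans hkl))) le_rfl
    · exact StronglyMeasurable.inner
        ((E.measurable k).mono (ℱ.mono ((E.time_le k).trans hkl))) (E.measurable l)

/-- The Itô isometry for elementary processes. -/
lemma lintegral_enorm_integral_sq [IsProbabilityMeasure P] (E : ElementaryProcess ℱ K)
    (hW : IsStandardBrownianMotion ℱ P W) (t : Icc (0 : ℝ) T) :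
    ∫⁻ ω, ‖E.integral W t ω‖ₑ ^ 2 ∂P
      = ∫⁻ s in Iic t, ∫⁻ ω, ‖E.eval s ω‖ₑ ^ 2 ∂P ∂(timeMeasure T) := by
  have hint : ∀ k l : Fin E.n, Integrable (fun ω =>
      inner ℝ ((W (min (E.time k.succ) t) ω - W (min (E.time k.castSucc) t) ω) • E.value k ω)
      ((W (min (E.time l.succ) t) ω - W (min (E.time l.castSucc) t) ω) • E.value l ω)) P :=
    fun k l => ((E.memLp_summand hW t k).norm.integrable_mul (E.memLp_summand hW t l).norm).mono'
      ((E.memLp_summand hW t k).1.inner (E.memLp_summand hW t l).1)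
      (ae_of_all _ fun ω => norm_inner_le_norm _ _)
  have hd : ∀ k : Fin E.n, 0 ≤ ((min (E.time k.succ) t : Icc (0 : ℝ) T) : ℝ)
      - (min (E.time k.castSucc) t : Icc (0 : ℝ) T) := fun k =>
    sub_nonneg.2 (min_le_min_right t (E.time_le k) : min (E.time k.castSucc) t ≤ _)
  have hsum : ∀ k : Fin E.n, ∑ l : Fin E.n, ∫ ω,
      inner ℝ ((W (min (E.time k.succ) t) ω - W (min (E.time k.castSucc) t) ω) • E.value k ω)
      ((W (min (E.time l.succ) t) ω - W (min (E.time l.castSucc) t) ω) • E.value l ω) ∂P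
      = (((min (E.time k.succ) t : Icc (0 : ℝ) T) : ℝ)
          - (min (E.time k.castSucc) t : Icc (0 : ℝ) T)) * ∫ ω, ‖E.value k ω‖ ^ 2 ∂P := by
    -- Only the diagonal term survives; off the diagonal the later of the two increments is averaged
    -- out, using symmetry of the inner product when `l < k`.
    intro k
    rw [Finset.sum_eq_single k _ (by simp), ← hW.integral_stopped_increment_sq_mul (E.time_le k) t
      ((E.measurable k).norm.measurable.pow_const 2)]
    · simp_rw [real_inner_self_eq_norm_sq, norm_smul, mul_pow, Real.norm_eq_abs, sq_abs]
    · intro l _ hl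
      rcases lt_or_gt_of_ne hl with h | h
      · exact Eq.trans (integral_congr_ae (ae_of_all _ fun ω => real_inner_comm _ _))
          (E.integral_inner_summand_of_lt hW t h)
      · exact E.integral_inner_summand_of_lt hW t h
  rw [lintegral_enorm_sq_eq_ofReal_integral (E.memLp_integral hW t), E.lintegral_enorm_eval_sq]
  simp_rw [lintegral_enorm_sq_eq_ofReal_integral (E.memLp_value _),
    ← ENNReal.ofReal_mul (hd _)]
  rw [← ENNReal.ofReal_sum_of_nonneg fun k _ => mul_nonneg (hd k)
    (integral_nonneg fun ω => sq_nonneg _)]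
  congr 1
  simp_rw [← hsum, ← real_inner_self_eq_norm_sq (E.integral W t _), integral, sum_inner, inner_sum]
  rw [integral_finsetSum _ fun k _ => integrable_finsetSum _ fun l _ => hint k l]
  exact Finset.sum_congr rfl fun k _ => integral_finsetSum _ fun l _ => hint k l

end ElementaryProcess

end Elementary

/-! ### Itô integral: isometry inequality and orthogonality by approximation -/

lemma le_of_tendsto_add_add {u v : ℝ≥0∞} {a b : ℕ → ℝ≥0∞} (ha : Tendsto a atTop (𝓝 0))
    (hb : Tendsto b atTop (𝓝 0)) (h : ∀ n, u ≤ a n + v + b n) : u ≤ v := by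
  refine ge_of_tendsto' (x := atTop) (f := fun n => a n + v + b n) ?_ h
  simpa using (ha.add_const v).add hb

section ItoIntegral

variable {T : ℝ} [Fact ((0 : ℝ) ≤ T)] {Ω : Type*} {mΩ : MeasurableSpace Ω}

lemma eLpNorm_two_eq_lintegral_rpow {α F : Type*} {mα : MeasurableSpace α} [NormedAddCommGroup F]
    (f : α → F) (m : Measure α) :
    eLpNorm f 2 m = (∫⁻ x, ‖f x‖ₑ ^ 2 ∂m) ^ (1 / 2 : ℝ) := by
  rw [eLpNorm_eq_lintegral_rpow_enorm_toReal two_ne_zero ENNReal.ofNat_ne_top]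
  simp

lemma eLpNorm_two_sq {α F : Type*} {mα : MeasurableSpace α} [NormedAddCommGroup F]
    (f : α → F) (m : Measure α) : eLpNorm f 2 m ^ 2 = ∫⁻ x, ‖f x‖ₑ ^ 2 ∂m := by
  rw [eLpNorm_two_eq_lintegral_rpow, ← ENNReal.rpow_natCast, ← ENNReal.rpow_mul]
  norm_num

lemma predictable_le_prod (ℱ : Filtration (Icc (0 : ℝ) T) mΩ) :
    ℱ.predictable ≤ (inferInstance : MeasurableSpace (Icc (0 : ℝ) T × Ω)) :=
  measurableSpace_le_predictable_of_measurableSet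
    (fun _ hA => (measurableSet_singleton _).prod (ℱ.le _ _ hA))
    (fun _ _ hA => measurableSet_Ioi.prod (ℱ.le _ _ hA))

/-- Pythagoras in L²: the cross term vanishes and the square of `g` only adds mass. -/
lemma eLpNorm_le_eLpNorm_add_of_integral_mul_eq_zero {P : Measure Ω} {f g : Ω → ℝ}
    (hf : MemLp f 2 P) (hg : MemLp g 2 P) (h : ∫ ω, f ω * g ω ∂P = 0) :
    eLpNorm f 2 P ≤ eLpNorm (fun ω => f ω + g ω) 2 P := by
  rw [eLpNorm_two_eq_lintegral_rpow, eLpNorm_two_eq_lintegral_rpow,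
    lintegral_enorm_sq_eq_ofReal_integral hf, lintegral_enorm_sq_eq_ofReal_integral (f := fun ω => f ω + g ω) (hf.add hg)]
  refine ENNReal.rpow_le_rpow (ENNReal.ofReal_le_ofReal ?_) (by norm_num)
  have hf2 := hf.integrable_sq
  have hg2 := hg.integrable_sq
  have hfg : Integrable (fun ω => 2 * (f ω * g ω)) P := (hf.integrable_mul hg).const_mul 2
  have e : ∀ ω, ‖f ω + g ω‖ ^ 2 = f ω ^ 2 + (2 * (f ω * g ω) + g ω ^ 2) := fun ω => by
    rw [Real.norm_eq_abs, sq_abs]; ring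
  simp_rw [e]
  rw [integral_add hf2 (g := fun ω => 2 * (f ω * g ω) + g ω ^ 2) (hfg.add hg2),
    integral_add hfg hg2,
    integral_const_mul, h]
  simp_rw [Real.norm_eq_abs, sq_abs]
  have := integral_nonneg (μ := P) (f := fun ω => g ω ^ 2) fun ω => sq_nonneg (g ω)
  simp only [mul_zero, zero_add]
  linarith

variable {ℱ : Filtration (Icc (0 : ℝ) T) mΩ} {P : Measure Ω}
  {W : Icc (0 : ℝ) T → Ω → ℝ} {K : Type*} [NormedAddCommGroup K] [InnerProductSpace ℝ K]
  {Φ : Icc (0 : ℝ) T → Ω → K} {t : Icc (0 : ℝ) T} {I : Ω → K}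

namespace IsItoIntegral

/-- One half of the Itô isometry. -/
lemma lintegral_enorm_sq_le [IsProbabilityMeasure P] (hI : IsItoIntegral ℱ P W Φ t I)
    (hW : IsStandardBrownianMotion ℱ P W) :
    ∫⁻ s in Iic t, ∫⁻ ω, ‖Φ s ω‖ₑ ^ 2 ∂P ∂(timeMeasure T) ≤ ∫⁻ ω, ‖I ω‖ₑ ^ 2 ∂P := by
  obtain ⟨E, hE, hEI⟩ := hI.approx
  set m := ((timeMeasure T).restrict (Iic t)).prod P
  have hΦ : AEStronglyMeasurable (Function.uncurry Φ) m :=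
    hI.predictable.mono (predictable_le_prod ℱ)
  have hEm : ∀ n, AEStronglyMeasurable (Function.uncurry (E n).eval) m := fun n =>
    (E n).stronglyMeasurable_eval.aestronglyMeasurable
  -- By Tonelli the iterated integrals are squared L² norms for the product measure `m`, where the
  -- triangle inequality is available.
  have hprod : ∀ F : Icc (0 : ℝ) T → Ω → K, AEStronglyMeasurable (Function.uncurry F) m →
      ∫⁻ s in Iic t, ∫⁻ ω, ‖F s ω‖ₑ ^ 2 ∂P ∂(timeMeasure T)
        = eLpNorm (Function.uncurry F) 2 m ^ 2 := by
    intro F hF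
    rw [eLpNorm_two_sq, lintegral_prod _ (hF.enorm.pow_const 2)]
    rfl
  have hE' : Tendsto (fun n => eLpNorm (Function.uncurry (E n).eval - Function.uncurry Φ) 2 m)
      atTop (𝓝 0) := by
    have h2 := hE.ennrpow_const (1 / 2 : ℝ)
    rw [ENNReal.zero_rpow_of_pos (by norm_num)] at h2
    refine h2.congr fun n => ?_
    rw [hprod (fun s ω => (E n).eval s ω - Φ s ω) ((hEm n).sub hΦ), ← ENNReal.rpow_natCast,
      ← ENNReal.rpow_mul]
    norm_num
    rfl
  rw [hprod Φ hΦ, ← eLpNorm_two_sq]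
  gcongr
  refine le_of_tendsto_add_add hE' hEI fun n => ?_
  have hiso : eLpNorm (Function.uncurry (E n).eval) 2 m = eLpNorm ((E n).integral W t) 2 P := by
    rw [← ENNReal.pow_right_strictMono two_ne_zero |>.injective.eq_iff, ← hprod _ (hEm n),
      eLpNorm_two_sq, (E n).lintegral_enorm_integral_sq hW]
  have hJ := ((E n).memLp_integral hW t).1
  calc eLpNorm (Function.uncurry Φ) 2 m
      = eLpNorm (Function.uncurry (E n).eval
          - (Function.uncurry (E n).eval - Function.uncurry Φ)) 2 m := by rw [sub_sub_cancel]
    _ ≤ eLpNorm (Function.uncurry (E n).eval) 2 m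
        + eLpNorm (Function.uncurry (E n).eval - Function.uncurry Φ) 2 m :=
        eLpNorm_sub_le (hEm n) ((hEm n).sub hΦ) (by norm_num)
    _ = eLpNorm (Function.uncurry (E n).eval - Function.uncurry Φ) 2 m
        + eLpNorm (((E n).integral W t - I) + I) 2 P := by rw [hiso, sub_add_cancel, add_comm]
    _ ≤ eLpNorm (Function.uncurry (E n).eval - Function.uncurry Φ) 2 m
        + (eLpNorm ((E n).integral W t - I) 2 P + eLpNorm I 2 P) := by
        gcongr
        exact eLpNorm_add_le (hJ.sub hI.memLp.1) hI.memLp.1 (by norm_num)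
    _ = _ := by rw [add_comm (eLpNorm ((E n).integral W t - I) 2 P), add_assoc]; rfl

/-- Scalar elementary integrals are already orthogonal to the variables known at time zero, and a
bounded functional preserves their L² convergence. -/
lemma exists_orthogonal_approx (hI : IsItoIntegral ℱ P W Φ t I)
    (hW : IsStandardBrownianMotion ℱ P W) (L : K →L[ℝ] ℝ) :
    ∃ J : ℕ → Ω → ℝ, (∀ n, MemLp (J n) 2 P) ∧
      (∀ n, ∀ ζ : Ω → ℝ, Measurable[ℱ ⊥] ζ → MemLp ζ 2 P → ∫ ω, ζ ω * J n ω ∂P = 0) ∧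
      Tendsto (fun n => eLpNorm (J n - fun ω => L (I ω)) 2 P) atTop (𝓝 0) := by
  obtain ⟨E, -, hEI⟩ := hI.approx
  refine ⟨fun n ω => L ((E n).integral W t ω), fun n => L.comp_memLp' ((E n).memLp_integral hW t),
    fun n ζ hζ hζ2 => (E n).integral_mul_eq_zero hW t L hζ hζ2, ?_⟩
  have h0 : Tendsto (fun n => ENNReal.ofReal ‖L‖
      * eLpNorm (fun ω => (E n).integral W t ω - I ω) 2 P) atTop (𝓝 0) := by
    have := ENNReal.Tendsto.const_mul (a := ENNReal.ofReal ‖L‖) hEI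
      (Or.inr ENNReal.ofReal_ne_top)
    rwa [mul_zero] at this
  refine tendsto_of_tendsto_of_tendsto_of_le_of_le tendsto_const_nhds h0 (fun _ => zero_le) ?_
  intro n
  refine eLpNorm_le_mul_eLpNorm_of_ae_le_mul (ae_of_all _ fun ω => ?_) 2
  rw [Pi.sub_apply, ← map_sub]
  exact L.le_opNorm _

/-- The Itô integral is orthogonal to the random variables known at time zero. -/
lemma lintegral_enorm_sq_le_add (hI : IsItoIntegral ℱ P W Φ t I)
    (hW : IsStandardBrownianMotion ℱ P W) (L : K →L[ℝ] ℝ) {ζ : Ω → ℝ} (hζ : Measurable[ℱ ⊥] ζ)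
    (hζ2 : MemLp ζ 2 P) :
    ∫⁻ ω, ‖ζ ω‖ₑ ^ 2 ∂P ≤ ∫⁻ ω, ‖ζ ω + L (I ω)‖ₑ ^ 2 ∂P ∧
      ∫⁻ ω, ‖L (I ω)‖ₑ ^ 2 ∂P ≤ ∫⁻ ω, ‖ζ ω + L (I ω)‖ₑ ^ 2 ∂P := by
  obtain ⟨J, hJ, hJ0, hJI⟩ := hI.exists_orthogonal_approx hW L
  set LI : Ω → ℝ := fun ω => L (I ω)
  have hLI : MemLp LI 2 P := L.comp_memLp' hI.memLp
  have hsum : ∀ n, eLpNorm (ζ + J n) 2 P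
      ≤ eLpNorm (J n - LI) 2 P + eLpNorm (ζ + LI) 2 P := fun n =>
    calc eLpNorm (ζ + J n) 2 P = eLpNorm ((J n - LI) + (ζ + LI)) 2 P := by congr 1; abel
      _ ≤ _ := eLpNorm_add_le ((hJ n).sub hLI).1 (hζ2.add hLI).1 (by norm_num)
  have hsq : ∀ f : Ω → ℝ, eLpNorm f 2 P ≤ eLpNorm (ζ + LI) 2 P →
      ∫⁻ ω, ‖f ω‖ₑ ^ 2 ∂P ≤ ∫⁻ ω, ‖ζ ω + LI ω‖ₑ ^ 2 ∂P := by
    intro f h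
    have := pow_le_pow_left' h 2
    rwa [eLpNorm_two_sq, eLpNorm_two_sq] at this
  refine ⟨hsq _ ?_, hsq _ ?_⟩
  -- Pythagoras is applied to the approximant `J n`, and the error is absorbed in the limit; the
  -- second bound also pays for replacing `LI` by `J n` on the left.
  · refine le_of_tendsto_add_add hJI tendsto_const_nhds fun n => ?_
    rw [add_zero]
    exact (eLpNorm_le_eLpNorm_add_of_integral_mul_eq_zero hζ2 (hJ n) (hJ0 n ζ hζ hζ2)).trans
      (hsum n)
  · refine le_of_tendsto_add_add hJI hJI fun n => ?_
    have h1 : eLpNorm LI 2 P ≤ eLpNorm (J n) 2 P + eLpNorm (J n - LI) 2 P :=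
      calc eLpNorm LI 2 P = eLpNorm (J n - (J n - LI)) 2 P := by rw [sub_sub_cancel]
        _ ≤ _ := eLpNorm_sub_le (hJ n).1 ((hJ n).sub hLI).1 (by norm_num)
    refine h1.trans (add_le_add ?_ le_rfl)
    refine (eLpNorm_le_eLpNorm_add_of_integral_mul_eq_zero (hJ n) hζ2 ?_).trans
      ((le_of_eq ?_).trans (hsum n))
    · simp_rw [mul_comm (J n _)]
      exact hJ0 n ζ hζ hζ2
    · congr 1
      ext ω
      exact add_comm _ _

end IsItoIntegral

end ItoIntegral

/-! ### Norms of the interpolation scale as coefficient series -/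

section Scale

variable {ι : Type*}

lemma lp_enorm_sq (f : lp (fun _ : ι => ℝ) 2) : ‖f‖ₑ ^ 2 = ∑' i, ‖f i‖ₑ ^ 2 := by
  have h2 : (0 : ℝ) < (2 : ℝ≥0∞).toReal := by norm_num
  have h := lp.hasSum_norm h2 f
  simp only [ENNReal.toReal_ofNat, Real.rpow_ofNat] at h
  rw [← ofReal_norm, ← ENNReal.ofReal_pow (norm_nonneg _), ← h.tsum_eq,
    ENNReal.ofReal_tsum_of_nonneg (fun i => by positivity) h.summable]
  congr with i
  rw [ENNReal.ofReal_pow (norm_nonneg _), ofReal_norm]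

lemma memℓp_two_of_tsum_enorm_sq_ne_top {f : ι → ℝ} (h : ∑' i, ‖f i‖ₑ ^ 2 ≠ ∞) :
    Memℓp f 2 := by
  have h2 : (0 : ℝ) < (2 : ℝ≥0∞).toReal := by norm_num
  rw [memℓp_gen_iff h2]
  have e : ∀ i, ‖f i‖ₑ ^ 2 = ((‖f i‖₊ ^ 2 : ℝ≥0) : ℝ≥0∞) := fun i => by
    rw [ENNReal.coe_pow]; rfl
  simp_rw [e] at h
  have := NNReal.summable_coe.2 (ENNReal.tsum_coe_ne_top_iff_summable.1 h)
  simpa using this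

lemma InterpSpace.enorm_sq {μ : Weight ι} {q : ℝ} (x : InterpSpace μ q) :
    ‖x‖ₑ ^ 2 = ∑' i, ‖μ.1 i ^ q * x.coeffs i‖ₑ ^ 2 := by
  have : ‖x‖ₑ = ‖toL2 μ q x‖ₑ := by rw [← ofReal_norm, norm_def, ofReal_norm]
  rw [this, lp_enorm_sq]
  rfl

/-- Outside `H_q` the series diverges, which matches the value `∞` of the norm. The second moments
can therefore be handled as series before it is known that `ξ` lies in `H_{-1/2}`. -/
lemma interpENorm_sq (μ : Weight ι) (q : ℝ) (x : ι → ℝ) :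
    interpENorm μ q x ^ 2 = ∑' i, ‖μ.1 i ^ q * x i‖ₑ ^ 2 := by
  rw [interpENorm]
  split_ifs with h
  · exact InterpSpace.enorm_sq _
  · by_contra hne
    exact h (memℓp_two_of_tsum_enorm_sq_ne_top fun h' => hne (by rw [h']; simp))

lemma mem_interpSubmodule_of_interpENorm_ne_top {μ : Weight ι} {q : ℝ} {x : ι → ℝ}
    (h : interpENorm μ q x ≠ ∞) : x ∈ interpSubmodule μ q := by
  by_contra hx
  exact h (dif_neg hx)

/-- The `i`-th coefficient as a bounded functional on `H_q`. -/
def InterpSpace.coeffCLM (μ : Weight ι) (q : ℝ) (i : ι) : InterpSpace μ q →L[ℝ] ℝ :=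
  LinearMap.mkContinuous
    { toFun := fun x => x.coeffs i
      map_add' := fun _ _ => rfl
      map_smul' := fun _ _ => rfl } (μ.1 i ^ q)⁻¹ (fun x => by
    have hq := Real.rpow_pos_of_pos (μ.pos i) q
    have h := lp.norm_apply_le_norm two_ne_zero (toL2 μ q x) i
    have e : toL2 μ q x i = μ.1 i ^ q * x.coeffs i := rfl
    rw [e, norm_mul, Real.norm_of_nonneg hq.le] at h
    rw [inv_mul_eq_div, le_div_iff₀ hq, mul_comm]
    exact h)

variable {H : Type*} [NormedAddCommGroup H] [InnerProductSpace ℝ H]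

lemma toH_enorm_sq (b : HilbertBasis ι ℝ H) {x : ι → ℝ} (hx : x ∈ range (coeff b)) :
    ‖toH b x‖ₑ ^ 2 = ∑' i, ‖x i‖ₑ ^ 2 := by
  obtain ⟨v, rfl⟩ := hx
  have : ‖v‖ₑ = ‖b.repr v‖ₑ := by rw [← ofReal_norm, ← ofReal_norm, LinearIsometryEquiv.norm_map]
  rw [toH_coeff, this, lp_enorm_sq]
  simp [coeff, b.repr_apply_apply]

/-- Distinct basis vectors are at distance `√2`, so balls of radius `1/2` around them are disjoint
open sets in a separable space. Countability is what permits exchanging expectation and coefficient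
sums. -/
lemma countable_of_hilbertBasis [TopologicalSpace.SeparableSpace H] (b : HilbertBasis ι ℝ H) :
    Countable ι := by
  refine Pairwise.countable_of_isOpen_disjoint (s := fun i => Metric.ball (b i) (1 / 2)) ?_
    (fun i => Metric.isOpen_ball) (fun i => ⟨b i, Metric.mem_ball_self (by norm_num)⟩)
  intro i j hij
  rw [Function.onFun, Set.disjoint_left]
  intro x hi hj
  rw [Metric.mem_ball, dist_comm] at hi
  rw [Metric.mem_ball] at hj
  have h1 : ‖b i - b j‖ < 1 := by
    rw [← dist_eq_norm]
    linarith [dist_triangle (b i) x (b j)]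
  have h2 := norm_sub_sq_real (b i) (b j)
  rw [b.orthonormal.1 i, b.orthonormal.1 j, b.orthonormal.2 hij] at h2
  nlinarith [norm_nonneg (b i - b j)]

end Scale

/-! ### Spectral bounds and comparison of semigroup norms -/

section Spectrum

variable {H : Type*} [NormedAddCommGroup H] [InnerProductSpace ℝ H] {ι : Type*}
  {A : H →ₗ.[ℝ] H} {b : HilbertBasis ι ℝ H} {lam : ι → ℝ} {η : ℝ}

lemma pointSpectrum_subset_opSpectrum (A : H →ₗ.[ℝ] H) : pointSpectrum A ⊆ opSpectrum A := by
  rintro z ⟨v, hv, hz⟩ ⟨R, -, hR⟩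
  have := hR v
  rw [hz, sub_self, map_zero] at this
  exact hv this.symm

lemma IsDiagonal.neg_lam_mem_pointSpectrum (hA : IsDiagonal A b lam) (i : ι) :
    -lam i ∈ pointSpectrum A := by
  obtain ⟨h, hi⟩ := hA.apply_basis i
  exact ⟨⟨b i, h⟩, b.orthonormal.ne_zero i, by rw [hi, neg_smul]⟩

lemma IsDiagonal.sub_sSup_le_weight (hA : IsDiagonal A b lam) (hη : opSpectrum A ⊆ Iio η)
    (i : ι) : η - sSup (pointSpectrum A) ≤ η + lam i := by
  have hb : BddAbove (pointSpectrum A) :=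
    ⟨η, fun z hz => (hη (pointSpectrum_subset_opSpectrum A hz)).le⟩
  linarith [le_csSup hb (hA.neg_lam_mem_pointSpectrum i)]

/-- An index supplies an eigenvalue; without one, `sSup ∅ = 0` would carry no information. -/
lemma IsDiagonal.sub_sSup_nonneg [Nonempty ι] (hA : IsDiagonal A b lam)
    (hη : opSpectrum A ⊆ Iio η) : 0 ≤ η - sSup (pointSpectrum A) := by
  obtain ⟨i⟩ := ‹Nonempty ι›
  exact sub_nonneg.2 (csSup_le ⟨_, hA.neg_lam_mem_pointSpectrum i⟩
    fun z hz => (hη (pointSpectrum_subset_opSpectrum A hz)).le)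

lemma IsDiagonal.enorm_semigroup_mul_le (hA : IsDiagonal A b lam) (hη : opSpectrum A ⊆ Iio η)
    {s t p q : ℝ} (hs : 0 ≤ s) (hst : s < t) (w : hA.Interp hη p) :
    ‖hA.semigroup hη t p q w‖ₑ ^ 2 * ENNReal.ofReal (Real.exp (-2 * η * s))
      ≤ ‖hA.semigroup hη (t - s) p q w‖ₑ ^ 2 := by
  rw [InterpSpace.enorm_sq, InterpSpace.enorm_sq, ← ENNReal.tsum_mul_right]
  refine ENNReal.tsum_le_tsum fun i => ?_
  rw [hA.semigroup_coeffs hη (hs.trans_lt hst), hA.semigroup_coeffs hη (sub_pos.2 hst)]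
  have hi : 0 < η + lam i := (hA.weight hη).pos i
  have e : Real.exp (-2 * η * s) = Real.exp (-η * s) ^ 2 := by
    rw [← Real.exp_nat_mul]; congr 1; push_cast; ring
  rw [e, ENNReal.ofReal_pow (Real.exp_pos _).le, ← mul_pow,
    ← Real.enorm_of_nonneg (Real.exp_pos _).le, ← enorm_mul]
  refine pow_le_pow_left' (enorm_le_iff_norm_le.2 ?_) 2
  have key : Real.exp (-lam i * t) * Real.exp (-η * s) ≤ Real.exp (-lam i * (t - s)) := by
    rw [← Real.exp_add, Real.exp_le_exp]
    -- After cancellation the claim is `0 ≤ (η + lam i) * s`.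
    nlinarith
  calc ‖(hA.weight hη).1 i ^ q * (Real.exp (-lam i * t) * w.coeffs i) * Real.exp (-η * s)‖
      = (Real.exp (-lam i * t) * Real.exp (-η * s))
        * ‖(hA.weight hη).1 i ^ q * w.coeffs i‖ := by
        rw [norm_mul, norm_mul, norm_mul, norm_mul, Real.norm_of_nonneg (Real.exp_pos _).le,
          Real.norm_of_nonneg (Real.exp_pos _).le]
        ring
    _ ≤ Real.exp (-lam i * (t - s)) * ‖(hA.weight hη).1 i ^ q * w.coeffs i‖ := by gcongr
    _ = _ := by
        rw [norm_mul, norm_mul, norm_mul, Real.norm_of_nonneg (Real.exp_pos (_ * (t - s))).le]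
        ring

end Spectrum

/-! ### Integrals over the time interval -/

section TimeIntegral

variable {T : ℝ}

lemma timeMeasure_singleton (s : Icc (0 : ℝ) T) : timeMeasure T {s} = 0 := by
  rw [timeMeasure, (MeasurableEmbedding.subtype_coe measurableSet_Icc).comap_apply]
  simp

lemma lintegral_Iic_timeMeasure (t : Icc (0 : ℝ) T) {f : ℝ → ℝ≥0∞} (hf : Measurable f) :
    ∫⁻ s in Iic t, f s ∂(timeMeasure T) = ∫⁻ s in Ioc (0 : ℝ) t, f s := by
  have he := MeasurableEmbedding.subtype_coe (measurableSet_Icc (a := (0 : ℝ)) (b := T))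
  have himg : Iic t = Subtype.val ⁻¹' (Icc (0 : ℝ) t) := by
    ext s
    exact ⟨fun h => ⟨s.2.1, h⟩, fun h => h.2⟩
  rw [Measure.restrict_congr_set Ioc_ae_eq_Icc, timeMeasure, himg, ← lintegral_map
    (μ := (Measure.comap Subtype.val volume).restrict (Subtype.val ⁻¹' (Icc (0 : ℝ) t))) hf
    measurable_subtype_coe, ← Measure.restrict_map measurable_subtype_coe measurableSet_Icc,
    he.map_comap, Measure.restrict_restrict measurableSet_Icc, Subtype.range_coe,
    inter_eq_left.2 (Icc_subset_Icc_right t.2.2)]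

lemma lintegral_Iic_exp_neg (t : Icc (0 : ℝ) T) {m : ℝ} (hm : 0 < m) :
    ∫⁻ s in Iic t, ENNReal.ofReal (Real.exp (-2 * m * s)) ∂(timeMeasure T)
      = ENNReal.ofReal ((1 - Real.exp (-2 * m * t)) / 2 * m⁻¹) := by
  rw [lintegral_Iic_timeMeasure t (f := fun s => ENNReal.ofReal (Real.exp (-2 * m * s)))
    (by fun_prop), ← ofReal_integral_eq_lintegral_ofReal
    ((by fun_prop : Continuous fun s => Real.exp (-2 * m * s)).integrableOn_Ioc)
    (ae_of_all _ fun s => (Real.exp_pos _).le), ← intervalIntegral.integral_of_le t.2.1]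
  congr 1
  have hne : -2 * m ≠ 0 := by simp [hm.ne']
  rw [intervalIntegral.integral_comp_mul_left (fun x => Real.exp x) hne, integral_exp]
  simp
  field_simp
  ring

end TimeIntegral

/-! ### Second moments of mild solutions -/

section MildSolution

variable {T : ℝ} [Fact ((0 : ℝ) ≤ T)] {Ω : Type*} {mΩ : MeasurableSpace Ω} {P : Measure Ω}
  {ℱ : Filtration (Icc (0 : ℝ) T) mΩ} {W : Icc (0 : ℝ) T → Ω → ℝ} {ι : Type*} {μ : Weight ι}
  {q : ℝ} {Φ : Icc (0 : ℝ) T → Ω → InterpSpace μ q} {t : Icc (0 : ℝ) T} {I Z : Ω → InterpSpace μ q}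

lemma memLp_coeffs (hZ : Measurable[ℱ ⊥] Z) (hZ2 : ∫⁻ ω, ‖Z ω‖ₑ ^ 2 ∂P < ∞) (i : ι) :
    MemLp (fun ω => (Z ω).coeffs i) 2 P := by
  refine ⟨((InterpSpace.coeffCLM μ q i).continuous.measurable.comp
    (hZ.mono (ℱ.le _) le_rfl)).aestronglyMeasurable, ?_⟩
  have h := eLpNorm_le_mul_eLpNorm_of_ae_le_mul (μ := P) (f := fun ω => (Z ω).coeffs i) (g := Z)
    (ae_of_all _ fun ω => (InterpSpace.coeffCLM μ q i).le_opNorm (Z ω)) 2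
  refine h.trans_lt (ENNReal.mul_lt_top ENNReal.ofReal_lt_top ?_)
  rw [eLpNorm_two_eq_lintegral_rpow]
  exact ENNReal.rpow_lt_top_of_nonneg (by norm_num) hZ2.ne

/-- Weighted second moments of the coefficients of the sum of an initial value and an Itô
integral dominate those of each summand. -/
lemma IsItoIntegral.lintegral_tsum_le [Countable ι] (hI : IsItoIntegral ℱ P W Φ t I)
    (hW : IsStandardBrownianMotion ℱ P W) (hZ : Measurable[ℱ ⊥] Z)
    (hZ2 : ∫⁻ ω, ‖Z ω‖ₑ ^ 2 ∂P < ∞) {X : Ω → ι → ℝ} (hX : ∀ᵐ ω ∂P, X ω = (Z ω + I ω).coeffs)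
    (c : ι → ℝ) :
    ∑' i, ∫⁻ ω, ‖c i * (Z ω).coeffs i‖ₑ ^ 2 ∂P ≤ ∫⁻ ω, ∑' i, ‖c i * X ω i‖ₑ ^ 2 ∂P ∧
      ∫⁻ ω, ∑' i, ‖c i * (I ω).coeffs i‖ₑ ^ 2 ∂P ≤ ∫⁻ ω, ∑' i, ‖c i * X ω i‖ₑ ^ 2 ∂P := by
  have hIm : ∀ i, MemLp (fun ω => (I ω).coeffs i) 2 P := fun i =>
    (InterpSpace.coeffCLM μ q i).comp_memLp' hI.memLp
  have hXc : ∫⁻ ω, ∑' i, ‖c i * X ω i‖ₑ ^ 2 ∂P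
      = ∑' i, ∫⁻ ω, ‖c i * (Z ω).coeffs i + c i * (I ω).coeffs i‖ₑ ^ 2 ∂P := by
    rw [← lintegral_tsum (f := fun i ω => ‖c i * (Z ω).coeffs i + c i * (I ω).coeffs i‖ₑ ^ 2)
      fun i => ((((memLp_coeffs hZ hZ2 i).const_mul (c i)).add
      ((hIm i).const_mul (c i))).1.enorm.pow_const 2)]
    refine lintegral_congr_ae (hX.mono fun ω h => ?_)
    simp only [h, ← mul_add]
    rfl
  -- Orthogonality is used one coefficient at a time, so the weights `c` are arbitrary and need not
  -- match the space `H_q` in which the integral is taken.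
  have key := fun i => hI.lintegral_enorm_sq_le_add hW (c i • InterpSpace.coeffCLM μ q i)
    (ζ := fun ω => c i * (Z ω).coeffs i)
    (((InterpSpace.coeffCLM μ q i).continuous.measurable.comp hZ).const_mul (c i))
    ((memLp_coeffs hZ hZ2 i).const_mul (c i))
  refine ⟨?_, ?_⟩
  · rw [hXc]
    exact ENNReal.tsum_le_tsum fun i => (key i).1
  · rw [hXc, lintegral_tsum fun i => ((hIm i).const_mul (c i)).1.enorm.pow_const 2]
    exact ENNReal.tsum_le_tsum fun i => (key i).2

lemma IsItoIntegral.lintegral_interpENorm_sq_lt_top (hI : IsItoIntegral ℱ P W Φ t I)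
    (hZ2 : ∫⁻ ω, ‖Z ω‖ₑ ^ 2 ∂P < ∞) {X : Ω → ι → ℝ} (hX : ∀ᵐ ω ∂P, X ω = (Z ω + I ω).coeffs) :
    ∫⁻ ω, interpENorm μ q (X ω) ^ 2 ∂P < ∞ := by
  have hI2 : ∫⁻ ω, ‖I ω‖ₑ ^ 2 ∂P < ∞ := by
    rw [← eLpNorm_two_sq]
    exact ENNReal.pow_lt_top hI.memLp.2
  have h : ∀ᵐ ω ∂P, interpENorm μ q (X ω) ^ 2 ≤ 2 * ‖Z ω‖ₑ ^ 2 + 2 * ‖I ω‖ₑ ^ 2 := by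
    filter_upwards [hX] with ω hω
    rw [hω, interpENorm_sq, ← InterpSpace.enorm_sq]
    calc ‖Z ω + I ω‖ₑ ^ 2 ≤ (‖Z ω‖ₑ + ‖I ω‖ₑ) ^ 2 := pow_le_pow_left' (enorm_add_le _ _) 2
      _ ≤ 2 * (‖Z ω‖ₑ ^ 2 + ‖I ω‖ₑ ^ 2) := by
        have := ENNReal.rpow_add_le_mul_rpow_add_rpow ‖Z ω‖ₑ ‖I ω‖ₑ one_le_two
        norm_num at this
        exact this
      _ = _ := mul_add _ _ _
  refine (lintegral_mono_ae h).trans_lt ?_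
  rw [lintegral_add_right' _ ((hI.memLp.1.enorm.pow_const 2).const_mul 2),
    lintegral_const_mul' _ _ (by simp), lintegral_const_mul' _ _ (by simp)]
  exact ENNReal.add_lt_top.2 ⟨ENNReal.mul_lt_top (by simp) hZ2, ENNReal.mul_lt_top (by simp) hI2⟩

end MildSolution

/-! ### Lower bound for the second moment -/

section LowerBound

/-- The lower bound for the second moment of the mild solution, with an arbitrary lower bound `γ`
for the eigenvalues of `η - A`. -/
lemma lintegral_interpENorm_sq_lower_bound
    {H : Type*} [NormedAddCommGroup H] [InnerProductSpace ℝ H] [CompleteSpace H]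
    [TopologicalSpace.SeparableSpace H]
    {T : ℝ} [Fact ((0 : ℝ) ≤ T)] (η δ : ℝ)
    {Ω : Type*} {mΩ : MeasurableSpace Ω} (P : Measure Ω) [IsProbabilityMeasure P]
    (ℱ : Filtration (Icc (0 : ℝ) T) mΩ)
    {ι : Type*} (A : H →ₗ.[ℝ] H) (b : HilbertBasis ι ℝ H) (lam : ι → ℝ)
    (hA : IsDiagonal A b lam) (hη : opSpectrum A ⊆ Iio η)
    (r β : ℝ)
    (w : hA.Interp hη (-β))
    (ξ : Ω → hA.Interp hη δ) (hξ : Measurable[ℱ ⊥] ξ)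
    (B : C(H, ℝ →L[ℝ] hA.Interp hη (-β))) (hB : ∀ (v : H) (u : ℝ), B v u = (u * ‖v‖) • w)
    (W : Icc (0 : ℝ) T → Ω → ℝ) (hW : IsStandardBrownianMotion ℱ P W)
    (X : Icc (0 : ℝ) T → Ω → hA.Interp hη δ)
    (hXH : ∀ t : Icc (0 : ℝ) T, 0 < (t : ℝ) → ∀ ω, (X t ω).coeffs ∈ range (coeff b))
    (hXint : ∀ t : Icc (0 : ℝ) T, 0 < (t : ℝ) →
      ∫⁻ ω, ‖hA.semigroup hη t δ (-r) (ξ ω)‖ₑ ^ 2 ∂P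
        + ∫⁻ s in Iic t, ∫⁻ ω,
            hsENorm ((hA.semigroup hη ((t : ℝ) - s) (-β) (-r)).comp
              (B (toH b (X s ω).coeffs))) ^ 2 ∂P ∂(timeMeasure T) < ∞)
    (hX : ∀ t : Icc (0 : ℝ) T, 0 < (t : ℝ) →
      ∃ I : Ω → hA.Interp hη (-r),
        IsItoIntegral ℱ P W
          (fun s ω => hA.semigroup hη ((t : ℝ) - s) (-β) (-r) (B (toH b (X s ω).coeffs) 1)) t I ∧
        ∀ᵐ ω ∂P, (X t ω).coeffs = (hA.semigroup hη t δ (-r) (ξ ω) + I ω).coeffs)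
    {t : Icc (0 : ℝ) T} (ht : 0 < (t : ℝ)) {γ : ℝ} (hγ : ∀ i, γ ≤ η + lam i) :
    ENNReal.ofReal ((1 - Real.exp (-2 * γ * t)) / 2) * ‖hA.semigroup hη t (-β) (-r) w‖ₑ ^ 2
        * ∫⁻ ω, interpENorm (hA.weight hη) (-(1 / 2)) (ξ ω).coeffs ^ 2 ∂P
      ≤ ∫⁻ ω, interpENorm (hA.weight hη) (-r) (X t ω).coeffs ^ 2 ∂P := by
  have : Countable ι := countable_of_hilbertBasis b
  set a : ι → ℝ≥0∞ := fun i => ∫⁻ ω, ‖(ξ ω).coeffs i‖ₑ ^ 2 ∂P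
  have hZ : ∀ s, Measurable[ℱ ⊥] fun ω => hA.semigroup hη s δ (-r) (ξ ω) := fun s =>
    (hA.semigroup hη s δ (-r)).continuous.measurable.comp hξ
  have hZ2 : ∀ s : Icc (0 : ℝ) T, 0 < (s : ℝ) →
      ∫⁻ ω, ‖hA.semigroup hη s δ (-r) (ξ ω)‖ₑ ^ 2 ∂P < ∞ := fun s hs =>
    lt_of_le_of_lt le_self_add (hXint s hs)
  have hμ : ∀ i, 0 < η + lam i := fun i => (hA.weight hη).pos i
  have hξm : ∀ i, Measurable fun ω => (ξ ω).coeffs i := fun i =>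
    ((InterpSpace.coeffCLM _ _ i).continuous.measurable.comp hξ).mono (ℱ.le _) le_rfl
  have hXH2 : ∀ s : Icc (0 : ℝ) T, 0 < (s : ℝ) →
      ∑' i, ENNReal.ofReal (Real.exp (-lam i * s)) ^ 2 * a i
        ≤ ∫⁻ ω, ‖toH b (X s ω).coeffs‖ₑ ^ 2 ∂P := by
    intro s hs
    obtain ⟨I, hI, hXI⟩ := hX s hs
    simp_rw [toH_enorm_sq b (hXH s hs _)]
    -- Unit weights give the norm of `H`, although the Itô integral is only known to live in
    -- `H_{-r}`.
    have h := (hI.lintegral_tsum_le hW (hZ s) (hZ2 s hs) hXI 1).1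
    simp only [Pi.one_apply, one_mul] at h
    refine le_trans (ENNReal.tsum_le_tsum fun i => le_of_eq ?_) h
    simp_rw [hA.semigroup_coeffs hη hs, enorm_mul, mul_pow,
      Real.enorm_of_nonneg (Real.exp_pos _).le]
    rw [lintegral_const_mul _ ((hξm i).enorm.pow_const 2)]
  obtain ⟨I, hI, hXI⟩ := hX t ht
  have hξN : ∫⁻ ω, interpENorm (hA.weight hη) (-(1 / 2)) (ξ ω).coeffs ^ 2 ∂P
      = ∑' i, ENNReal.ofReal (η + lam i)⁻¹ * a i := by
    simp_rw [interpENorm_sq, enorm_mul, mul_pow]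
    rw [lintegral_tsum fun i => (((hξm i).enorm.pow_const 2).const_mul _).aemeasurable]
    refine tsum_congr fun i => ?_
    rw [lintegral_const_mul _ ((hξm i).enorm.pow_const 2),
      Real.enorm_of_nonneg (Real.rpow_nonneg ((hA.weight hη).pos i).le _),
      ← ENNReal.ofReal_pow (Real.rpow_nonneg ((hA.weight hη).pos i).le _), ← Real.rpow_natCast,
      ← Real.rpow_mul ((hA.weight hη).pos i).le]
    norm_num
    rw [Real.rpow_neg_one]
    rfl
  set M := ‖hA.semigroup hη t (-β) (-r) w‖ₑ ^ 2
  have hΦ : ∀ᵐ s : Icc (0 : ℝ) T ∂(timeMeasure T).restrict (Iic t),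
      ∑' i, M * a i * ENNReal.ofReal (Real.exp (-2 * (η + lam i) * s))
      ≤ ∫⁻ ω, ‖hA.semigroup hη ((t : ℝ) - s) (-β) (-r) (B (toH b (X s ω).coeffs) 1)‖ₑ ^ 2 ∂P := by
    -- Both endpoints are discarded as null sets: at `s = 0` the process need not lie in `H`, and at
    -- `s = t` the operator `e^{(t-s)A}` may be unbounded, where `semigroup` takes the default value
    -- zero.
    have h0 : ∀ s₀ : Icc (0 : ℝ) T, ∀ᵐ s ∂(timeMeasure T).restrict (Iic t), s ≠ s₀ := fun s₀ =>
      ae_restrict_of_ae (by rw [ae_iff]; simpa using timeMeasure_singleton s₀)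
    filter_upwards [ae_restrict_mem measurableSet_Iic, h0 ⊥, h0 t] with s hst hs0 hs1
    have hs : 0 < (s : ℝ) := bot_lt_iff_ne_bot.2 hs0
    have hst' : (s : ℝ) < t := lt_of_le_of_ne hst (Subtype.coe_ne_coe.2 hs1)
    have e : ∀ ω, ‖hA.semigroup hη ((t : ℝ) - s) (-β) (-r) (B (toH b (X s ω).coeffs) 1)‖ₑ ^ 2
        = ‖hA.semigroup hη ((t : ℝ) - s) (-β) (-r) w‖ₑ ^ 2 * ‖toH b (X s ω).coeffs‖ₑ ^ 2 := by
      intro ω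
      rw [hB, one_mul, map_smul, enorm_smul, enorm_norm, mul_pow, mul_comm]
    simp_rw [e]
    rw [lintegral_const_mul' _ _ (by simp)]
    refine le_trans ?_ (mul_le_mul' (hA.enorm_semigroup_mul_le hη hs.le hst' w) (hXH2 s hs))
    rw [← ENNReal.tsum_mul_left]
    refine ENNReal.tsum_le_tsum fun i => le_of_eq ?_
    have e2 : Real.exp (-2 * (η + lam i) * s)
        = Real.exp (-2 * η * s) * Real.exp (-lam i * s) ^ 2 := by
      rw [← Real.exp_nat_mul, ← Real.exp_add]; congr 1; push_cast; ring
    rw [e2, ENNReal.ofReal_mul (Real.exp_pos _).le, ENNReal.ofReal_pow (Real.exp_pos _).le]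
    ring
  have hIX : ∫⁻ ω, ‖I ω‖ₑ ^ 2 ∂P
      ≤ ∫⁻ ω, interpENorm (hA.weight hη) (-r) (X t ω).coeffs ^ 2 ∂P := by
    simp_rw [interpENorm_sq, InterpSpace.enorm_sq]
    exact (hI.lintegral_tsum_le hW (hZ t) (hZ2 t ht) hXI _).2
  -- Read from the right: `X t` dominates the integral `I`, `I` dominates its integrand by the
  -- isometry, and the integrand dominates the exponential series.
  refine le_trans ?_ ((lintegral_mono_ae hΦ).trans ((hI.lintegral_enorm_sq_le hW).trans hIX))
  rw [lintegral_tsum fun i => by fun_prop, hξN, ← ENNReal.tsum_mul_left]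
  refine ENNReal.tsum_le_tsum fun i => ?_
  rw [lintegral_const_mul _ (by fun_prop), lintegral_Iic_exp_neg t (hμ i)]
  calc _ = M * a i * (ENNReal.ofReal ((1 - Real.exp (-2 * γ * t)) / 2)
        * ENNReal.ofReal (η + lam i)⁻¹) := by ring
    _ ≤ _ := by
      rw [← ENNReal.ofReal_mul' (inv_nonneg.2 (hμ i).le)]
      have := hμ i
      have := hγ i
      gcongr _ * ENNReal.ofReal ((1 - Real.exp ?_) / 2 * _)
      nlinarith

end LowerBound

end DiagonalSEE

end

/-! ### The proposition -/

open DiagonalSEE in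
theorem proposition3p4
    {H : Type*} [NormedAddCommGroup H] [InnerProductSpace ℝ H] [CompleteSpace H]
    [TopologicalSpace.SeparableSpace H]
    {T : ℝ} [Fact ((0 : ℝ) ≤ T)] (hT : 0 < T) (η δ : ℝ)
    -- the stochastic basis
    {Ω : Type*} {mΩ : MeasurableSpace Ω} (P : Measure Ω) [IsProbabilityMeasure P]
    (ℱ : Filtration (Icc (0 : ℝ) T) mΩ) (hℱ : IsNormalFiltration ℱ P)
    -- the diagonal operator
    {ι : Type*} (A : H →ₗ.[ℝ] H) (b : HilbertBasis ι ℝ H) (lam : ι → ℝ)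
    (hA : IsDiagonal A b lam) (hη : opSpectrum A ⊆ Iio η)
    (r β : ℝ) (hr : 0 ≤ r) (hβ : 0 ≤ β)
    (w : hA.Interp hη (-β)) (hw : w ≠ 0)
    (ξ : Ω → hA.Interp hη δ) (hξ : Measurable[ℱ ⊥] ξ)
    (B : C(H, ℝ →L[ℝ] hA.Interp hη (-β))) (hB : ∀ (v : H) (u : ℝ), B v u = (u * ‖v‖) • w)
    (W : Icc (0 : ℝ) T → Ω → ℝ) (hW : IsStandardBrownianMotion ℱ P W)
    (X : Icc (0 : ℝ) T → Ω → hA.Interp hη δ)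
    (hXpred : Measurable[ℱ.predictable] (Function.uncurry X))
    (hXH : ∀ t : Icc (0 : ℝ) T, 0 < (t : ℝ) → ∀ ω, (X t ω).coeffs ∈ range (coeff b))
    (hXint : ∀ t : Icc (0 : ℝ) T, 0 < (t : ℝ) →
      ∫⁻ ω, ‖hA.semigroup hη t δ (-r) (ξ ω)‖ₑ ^ 2 ∂P
        + ∫⁻ s in Iic t, ∫⁻ ω,
            hsENorm ((hA.semigroup hη ((t : ℝ) - s) (-β) (-r)).comp
              (B (toH b (X s ω).coeffs))) ^ 2 ∂P ∂(timeMeasure T) < ∞)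
    -- the mild formulation
    (hX : ∀ t : Icc (0 : ℝ) T, 0 < (t : ℝ) →
      ∃ I : Ω → hA.Interp hη (-r),
        IsItoIntegral ℱ P W
          (fun s ω => hA.semigroup hη ((t : ℝ) - s) (-β) (-r) (B (toH b (X s ω).coeffs) 1)) t I ∧
        ∀ᵐ ω ∂P, (X t ω).coeffs = (hA.semigroup hη t δ (-r) (ξ ω) + I ω).coeffs) :
    ∀ t : Icc (0 : ℝ) T, 0 < (t : ℝ) →
      (∀ᵐ ω ∂P, (ξ ω).coeffs ∈ interpSubmodule (hA.weight hη) (-(1 / 2))) ∧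
      ENNReal.ofReal ((2 : ℝ) ^ (-(1 / 2) : ℝ) * Real.exp (-|η| * t)
            * (1 - Real.exp (-2 * (η - sSup (pointSpectrum A)) * t)) ^ (1 / 2 : ℝ)
            * ‖hA.semigroup hη t (-β) (-r) w‖)
          * (∫⁻ ω, interpENorm (hA.weight hη) (-(1 / 2)) (ξ ω).coeffs ^ 2 ∂P) ^ (1 / 2 : ℝ)
        ≤ (∫⁻ ω, interpENorm (hA.weight hη) (-r) (X t ω).coeffs ^ 2 ∂P) ^ (1 / 2 : ℝ) ∧
      (∫⁻ ω, interpENorm (hA.weight hη) (-r) (X t ω).coeffs ^ 2 ∂P) ^ (1 / 2 : ℝ) < ∞ := by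
  intro t ht
  have : Countable ι := countable_of_hilbertBasis b
  have hlow := fun (γ : ℝ) (hγ : ∀ i, γ ≤ η + lam i) =>
    lintegral_interpENorm_sq_lower_bound η δ P ℱ A b lam hA hη r β w ξ hξ B hB W hW X hXH hXint hX
      ht hγ
  set N := ∫⁻ ω, interpENorm (hA.weight hη) (-(1 / 2)) (ξ ω).coeffs ^ 2 ∂P
  set R := ∫⁻ ω, interpENorm (hA.weight hη) (-r) (X t ω).coeffs ^ 2 ∂P
  have hR : R < ∞ := by
    obtain ⟨I, hI, hXI⟩ := hX t ht
    exact hI.lintegral_interpENorm_sq_lt_top (lt_of_le_of_lt le_self_add (hXint t ht)) hXI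
  -- A nonzero coefficient of `w` shows both that the index set is nonempty and that `e^{tA}w ≠ 0`.
  obtain ⟨i₀, hi₀⟩ : ∃ i, w.coeffs i ≠ 0 := by
    by_contra! h
    exact hw (Subtype.ext (funext h))
  have : Nonempty ι := ⟨i₀⟩
  have hSw : hA.semigroup hη t (-β) (-r) w ≠ 0 := by
    intro h
    have h1 := hA.semigroup_coeffs hη ht (-β) (-r) w i₀
    rw [h] at h1
    exact mul_ne_zero (Real.exp_pos _).ne' hi₀ h1.symm
  refine ⟨?_, ?_, ENNReal.rpow_lt_top_of_nonneg (by norm_num) hR.ne⟩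
  -- The uniform bound `c > 0` comes from the bounded resolvent at `η`. It makes the prefactor
  -- strictly positive, so `N = ∞` would contradict `R < ∞`.
  · obtain ⟨c, hc, hcμ⟩ := hA.weight_bound hη
    have hpos : 0 < (1 - Real.exp (-2 * c * t)) / 2 := by
      have : Real.exp (-2 * c * t) < 1 := Real.exp_lt_one_iff.2 (by nlinarith [mul_pos hc ht])
      linarith
    have hNtop : N ≠ ∞ := by
      intro h
      have := (hlow c hcμ).trans_lt hR
      rw [h, ENNReal.mul_top 
        (mul_ne_zero (ENNReal.ofReal_pos.2 hpos).ne' (pow_ne_zero 2 (enorm_ne_zero.2 hSw)))] at this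
      exact this.ne rfl
    have hmeas : Measurable fun ω =>
        interpENorm (hA.weight hη) (-(1 / 2)) (ξ ω).coeffs ^ 2 := by
      simp_rw [interpENorm_sq]
      refine Measurable.tsum fun i => Measurable.pow_const (Measurable.enorm ?_) 2
      exact (((InterpSpace.coeffCLM _ _ i).continuous.measurable.comp hξ).mono
        (ℱ.le _) le_rfl).const_mul _
    filter_upwards [ae_lt_top hmeas hNtop] with ω hω
    exact mem_interpSubmodule_of_interpENorm_ne_top fun h =>
      hω.ne (by rw [h, ENNReal.top_pow two_ne_zero])
  · set κ := η - sSup (pointSpectrum A)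
    have hκ0 : 0 ≤ κ := hA.sub_sSup_nonneg hη
    -- The sign is needed to split the real square root below.
    have hc0 : 0 ≤ 1 - Real.exp (-2 * κ * t) := by
      have : Real.exp (-2 * κ * t) ≤ 1 := Real.exp_le_one_iff.2 (by nlinarith [mul_nonneg hκ0 ht.le])
      linarith
    refine le_trans ?_ (ENNReal.rpow_le_rpow (hlow κ (hA.sub_sSup_le_weight hη))
      (by norm_num : (0 : ℝ) ≤ 1 / 2))
    rw [ENNReal.mul_rpow_of_nonneg _ _ (by norm_num)]
    gcongr
    rw [← ofReal_norm, ← ENNReal.ofReal_pow (norm_nonneg _),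
      ← ENNReal.ofReal_mul (by positivity), ENNReal.ofReal_rpow_of_nonneg (by positivity)
      (by norm_num)]
    refine ENNReal.ofReal_le_ofReal ?_
    rw [Real.mul_rpow (by positivity) (by positivity), ← Real.sqrt_eq_rpow (_ ^ 2),
      Real.sqrt_sq (norm_nonneg _), Real.div_rpow hc0 (by norm_num),
      Real.rpow_neg (by norm_num)]
    have he : Real.exp (-|η| * t) ≤ 1 :=
      Real.exp_le_one_iff.2 (by nlinarith [mul_nonneg (abs_nonneg η) ht.le])
    calc _ ≤ ((2 : ℝ) ^ (1 / 2 : ℝ))⁻¹ * 1 * (1 - Real.exp (-2 * κ * t)) ^ (1 / 2 : ℝ)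
          * ‖hA.semigroup hη t (-β) (-r) w‖ := by gcongr
      _ = _ := by ring
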